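/- Let $M\ge 2$ be an integer. Among the real numbers $q$ with $-2\le q\le 2$, $q\neq 0$ (those for which the following expression is defined) that satisfy $$\frac{\pi}{\arcsin(q/2)}\left(\frac{q\sqrt3+\sqrt{4-q^2}}{q}\right)+\sqrt{12}\,(1-M)\ \ge\ 0$$ there is a largest one; call it $q_m$ (it depends only on $M$). Let $R_c>0$, $0<\theta_B<\pi$ and $h>0$. Suppose that $M$ UAVs (unmanned aerial vehicles) with antenna beamwidth parameter $\theta_B$ fly at the common altitude $h$, so that each covers on the ground a disk of radius $r_u=h\tan(\theta_B/2)$ centred at its projection, and that they are placed over a circular target area of radius $R_c$ without coverage overlap; that is, with the centre of the target area as the origin, the projections $\vec r_1,\dots,\vec r_M\in\mathbb R^2$ satisfy $\|\vec r_j-\vec r_k\|\ge 2r_u$ for all $j\ne k$ (the coverage disks do not overlap) and $\|\vec r_j\|+r_u\le R_c$ for all $j$ (each coverage disk lies in the target area). Then $$h\ \le\ \frac{q_m R_c}{(2+q_m)\tan(\theta_B/2)} .$$ Equivalently, the right-hand side is an upper bound for all altitudes at which $M$ UAVs can be deployed over the target area without coverage overlap. -/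

import Mathlib

/-- The coverage radius on the ground of a UAV at altitude `h` whose directional antenna has
beamwidth `θ` (in radians): `r_u = h * tan (θ / 2)`. -/
noncomputable def coverageRadius (h θ : ℝ) : ℝ :=
  h * Real.tan (θ / 2)

/-- `M` UAVs at the common altitude `h`, with antenna beamwidth `θ`, whose projections onto the
ground are the points `r j` of the plane, serve the disk of radius `Rc` about the origin without
coverage overlap: the coverage disks (of radius `r_u` about the points `r j`) do not overlap, and
none of them leaves the target disk. -/
structure IsNonoverlappingDeployment (M : ℕ) (Rc θ h : ℝ)
    (r : Fin M → EuclideanSpace ℝ (Fin 2)) : Prop where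
  /-- Two distinct coverage disks have no interior point in common. -/
  no_overlap : ∀ j k : Fin M, j ≠ k → 2 * coverageRadius h θ ≤ ‖r j - r k‖
  /-- Every coverage disk lies in the target disk. -/
  inside : ∀ j : Fin M, ‖r j‖ + coverageRadius h θ ≤ Rc

/-- The real numbers `q` that satisfy
`(π / arcsin (q / 2)) * ((q √3 + √(4 - q²)) / q) + √12 (1 - M) ≥ 0`. The two conditions in front
say that the left-hand side is defined as a real number: `arcsin (q / 2)` and `√(4 - q²)` need
`-2 ≤ q ≤ 2`, and the divisions need `q ≠ 0`. -/
def packingInequalitySet (M : ℕ) : Set ℝ :=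
  {q : ℝ | q ∈ Set.Icc (-2 : ℝ) 2 ∧ q ≠ 0 ∧
    0 ≤ Real.pi / Real.arcsin (q / 2) * ((q * √3 + √(4 - q ^ 2)) / q) + √12 * (1 - (M : ℝ))}

/-! A deployment gives `M` centres in a disk of radius `Rc - r_u` with mutual distances at least
`2 r_u`. Scaled to the unit disk, they have mutual distances at least `q = 2 r_u / (Rc - r_u)`, and
the bound on `h` is the inequality `q ≤ qm` solved for `h`. So the content is that `M` points of the
unit disk at mutual distance at least `q` satisfy the packing inequality, which with
`α = arcsin (q / 2)` reads `M - 1 ≤ (π / α) (1 / 2 + cot α / (2 √3))`; this is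
`IsSeparatedInDisk.card_sub_one_le`. That a largest `q` exists is a compactness argument.

The right-hand side is what Groemer's inequality `M ≤ 2 A / (√3 q²) + P / (2 q) + 1` gives for a
"regular polygon with `π / α` sides" of length `q` inscribed in the circle, where `A` is the area
and `P` the perimeter of the convex hull. The proof has three ingredients.

* *Reduction to inscribed polygons.* An extreme point that is not on the circle can be moved to the
  circle along an outer normal, which only increases its distances to the others
  (`IsSeparatedInDisk.exists_move`). Hence the convex hull may be taken to be inscribed in the
  circle, with half central angles `a i ≥ α` of sum `π`. As `sin t / t` decreases,
  `A = ∑ sin (2 a i) / 2` and `P = ∑ 2 sin (a i)` are at most their values for the ideal regular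
  polygon (`sum_sin_le`).

* *A triangulation.* The points on the circle are triangulated by a fan, and the other points are
  inserted one at a time (`IsMesh.exists_insert_finset`). The number `F` of triangles and the number
  `B` of boundary edges then satisfy `F + B = 2 M - 2`, so Groemer's inequality becomes
  `√3 q² (F + B) ≤ 4 A + √3 q P`.

* *Groemer's inequality for meshes* (`IsMesh.card_add_card_le`). A mesh is only an oriented chain of
  triangles with prescribed boundary, so no planar topology is needed. By flipping edges the mesh
  may be assumed to be Delaunay: opposite angles at an inner edge have cotangents of nonnegative
  sum. If a boundary edge is opposite to an obtuse angle, its triangle is cut off, which preserves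
  `F + B` and does not increase `4 A + √3 q P`, and induction applies. Otherwise
  `4 A = ∑ ℓ² cot`, the sum being over all sides of all triangles, is at least `q² ∑ cot`, and the
  cotangents of each triangle add up to at least `√3`. Since also `P ≥ q B`, this is the claim. -/

/-! ### Triangles in the plane -/

/-- Twice the signed area of the triangle `a b c`; positive when it is oriented
counterclockwise. -/
def cross (a b c : ℂ) : ℝ :=
  (b.re - a.re) * (c.im - a.im) - (b.im - a.im) * (c.re - a.re)

/-- The inner product of `a - c` and `b - c`, whose sign is that of the cosine of the angle of the
triangle `a b c` at `c`. -/
def dotAt (a b c : ℂ) : ℝ :=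
  (a.re - c.re) * (b.re - c.re) + (a.im - c.im) * (b.im - c.im)

/-- The squared distance of two points. -/
def distSq (a b : ℂ) : ℝ := (a.re - b.re) ^ 2 + (a.im - b.im) ^ 2

/-- The cotangent of the angle at `c` of a counterclockwise triangle `a b c`. -/
noncomputable def cotAt (a b c : ℂ) : ℝ := dotAt a b c / cross a b c

lemma norm_sub_sq_eq_distSq (a b : ℂ) : ‖a - b‖ ^ 2 = distSq a b := by
  rw [Complex.sq_norm, Complex.normSq_apply, distSq, Complex.sub_re, Complex.sub_im]; ring

lemma distSq_comm (a b : ℂ) : distSq a b = distSq b a := by unfold distSq; ring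

lemma cross_rotate (a b c : ℂ) : cross b c a = cross a b c := by unfold cross; ring

lemma ne_of_cross_pos {a b c : ℂ} (h : 0 < cross a b c) : a ≠ b := by
  rintro rfl; simp [cross] at h

/-- The area formula `4 A = ∑ ℓ² cot`, the sum being over the sides and their opposite angles. -/
lemma two_mul_cross_eq_sum_cotAt {a b c : ℂ} (h : 0 < cross a b c) :
    2 * cross a b c = distSq a b * cotAt a b c + distSq b c * cotAt b c a
      + distSq c a * cotAt c a b := by
  unfold cotAt
  have h2 : cross b c a = cross a b c := cross_rotate a b c
  have h3 : cross c a b = cross a b c := by rw [cross_rotate b c a, h2]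
  rw [h2, h3]
  field_simp
  unfold cross dotAt distSq; ring

/-- The cotangents of the angles of a triangle add up to at least `√3`. -/
lemma sqrt_three_le_sum_cotAt {a b c : ℂ} (h : 0 < cross a b c) :
    √3 ≤ cotAt a b c + cotAt b c a + cotAt c a b := by
  unfold cotAt
  have h2 : cross b c a = cross a b c := cross_rotate a b c
  have h3 : cross c a b = cross a b c := by rw [cross_rotate b c a, h2]
  rw [h2, h3, ← add_div, ← add_div, le_div_iff₀ h]
  set x := dotAt a b c with hx
  set y := dotAt b c a with hy
  set z := dotAt c a b with hz
  have hxyz : x * y + y * z + z * x = cross a b c ^ 2 := by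
    rw [hx, hy, hz]; unfold cross dotAt; ring
  have hs : 0 ≤ x + y + z := by
    have : 2 * (x + y + z) = distSq a b + distSq b c + distSq c a := by
      rw [hx, hy, hz]; unfold dotAt distSq; ring
    have h4 : 0 ≤ distSq a b + distSq b c + distSq c a := by unfold distSq; positivity
    linarith
  refine abs_le_of_sq_le_sq' ?_ hs |>.2
  rw [mul_pow, Real.sq_sqrt (by norm_num), ← hxyz]
  nlinarith [sq_nonneg (x - y), sq_nonneg (y - z), sq_nonneg (z - x)]

/-- Cutting off a triangle `a b c` with an obtuse angle at `c` does not increase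
`4 A + √3 q P`: the loss of area outweighs the gain of perimeter. -/
lemma sqrt_three_mul_excess_le_cross {q : ℝ} (hq : 0 < q) {a b c : ℂ} (h : 0 < cross a b c)
    (hdot : dotAt a b c < 0) (hac : q ≤ ‖a - c‖) (hcb : q ≤ ‖c - b‖) :
    √3 * q * (‖a - c‖ + ‖c - b‖ - ‖a - b‖) ≤ 2 * cross a b c := by
  set f := ‖a - c‖ with hf
  set g := ‖c - b‖ with hg
  set e := ‖a - b‖ with he
  have hf2 : f ^ 2 = distSq a c := norm_sub_sq_eq_distSq a c
  have hg2 : g ^ 2 = distSq c b := norm_sub_sq_eq_distSq c b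
  have he2 : e ^ 2 = distSq a b := norm_sub_sq_eq_distSq a b
  have htri : e ≤ f + g := by
    have := norm_add_le (a - c) (c - b)
    rwa [sub_add_sub_cancel] at this
  have he0 : 0 ≤ e := norm_nonneg _
  have hcos : (f + g - e) * (f + g + e) = 2 * (f * g + dotAt a b c) := by
    have : distSq a c + distSq c b - distSq a b = 2 * dotAt a b c := by
      unfold distSq dotAt; ring
    nlinarith
  have hX : f * g + dotAt a b c ≤ cross a b c := by
    have hsq : cross a b c ^ 2 + dotAt a b c ^ 2 = (f * g) ^ 2 := by
      rw [mul_pow, hf2, hg2]; unfold cross dotAt distSq; ring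
    have hfg : 0 < f * g := mul_pos (by linarith) (by linarith)
    by_contra hlt
    push Not at hlt
    nlinarith
  have h3 : √3 ≤ 2 := by
    rw [Real.sqrt_le_left (by norm_num)]; norm_num
  have h3q : √3 * q ≤ f + g + e := by nlinarith
  calc √3 * q * (f + g - e) ≤ (f + g + e) * (f + g - e) :=
        mul_le_mul_of_nonneg_right h3q (by linarith)
    _ ≤ 2 * cross a b c := by linarith

/-! ### Flipping an edge -/

/-- The in-circle determinant of the edge `a b` with opposite vertices `c` and `d`: it is negative
exactly when the angles at `c` and `d` add up to more than `π`. -/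
lemma cross_mul_dotAt_add_eq (a b c d : ℂ) :
    cross a b c * dotAt b a d + cross b a d * dotAt a b c
      = cross a b c * distSq a d + cross b a d * distSq a c - cross a d c * distSq a b := by
  unfold cross dotAt distSq; ring

lemma cross_pos_of_flip {a b c d : ℂ} (hc : 0 < cross a b c) (hd : 0 < cross b a d)
    (h : cross a b c * dotAt b a d + cross b a d * dotAt a b c < 0) : 0 < cross a d c := by
  rw [cross_mul_dotAt_add_eq] at h
  have h1 : 0 ≤ distSq a d := by unfold distSq; positivity
  have h2 : 0 ≤ distSq a c := by unfold distSq; positivity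
  have h3 : 0 ≤ distSq a b := by unfold distSq; positivity
  by_contra hn
  push Not at hn
  nlinarith [mul_nonneg hc.le h1, mul_nonneg hd.le h2, mul_nonneg (neg_nonneg.2 hn) h3]

/-- Six times the volume between a triangle and the triangle that its vertices span after they are
lifted to the paraboloid `z = x² + y²`. A triangulation that minimizes the sum is Delaunay. -/
def liftVolume (T : ℂ × ℂ × ℂ) : ℝ :=
  cross T.1 T.2.1 T.2.2 * (distSq T.1 0 + distSq T.2.1 0 + distSq T.2.2 0)

lemma liftVolume_flip (a b c d : ℂ) :
    liftVolume (a, d, c) + liftVolume (d, b, c) = liftVolume (a, b, c) + liftVolume (b, a, d)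
      + (cross a b c * dotAt b a d + cross b a d * dotAt a b c) := by
  simp only [liftVolume, cross, dotAt, distSq, Complex.zero_re, Complex.zero_im]; ring

/-! ### Meshes -/

/-- The sum of `w` over the three directed sides of a triangle. -/
def sideSum (w : ℂ → ℂ → ℝ) (T : ℂ × ℂ × ℂ) : ℝ :=
  w T.1 T.2.1 + w T.2.1 T.2.2 + w T.2.2 T.1

/-- A finite family `𝒯` of counterclockwise triangles with vertices in `S` whose boundary, as a
chain of directed edges, is `D`. That the boundaries agree is expressed by duality: every
antisymmetric function has the same sum over the sides of `𝒯` as over `D`. The triangles are not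
required to have disjoint interiors. -/
structure IsMesh (S : Finset ℂ) (𝒯 : Multiset (ℂ × ℂ × ℂ)) (D : Multiset (ℂ × ℂ)) : Prop where
  vertex_mem : ∀ T ∈ 𝒯, T.1 ∈ S ∧ T.2.1 ∈ S ∧ T.2.2 ∈ S
  cross_pos : ∀ T ∈ 𝒯, 0 < cross T.1 T.2.1 T.2.2
  edge_mem : ∀ e ∈ D, e.1 ∈ S ∧ e.2 ∈ S ∧ e.1 ≠ e.2
  boundary : ∀ w : ℂ → ℂ → ℝ, (∀ a b, w a b = -w b a) →
    (𝒯.map (sideSum w)).sum = (D.map fun e => w e.1 e.2).sum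

/-- `T` is the triangle `a b c` up to the choice of the first vertex. -/
def IsRotation (T : ℂ × ℂ × ℂ) (a b c : ℂ) : Prop :=
  T = (a, b, c) ∨ T = (b, c, a) ∨ T = (c, a, b)

namespace IsRotation

variable {T : ℂ × ℂ × ℂ} {a b c : ℂ}

lemma sideSum_eq (h : IsRotation T a b c) (w : ℂ → ℂ → ℝ) :
    sideSum w T = w a b + w b c + w c a := by
  rcases h with rfl | rfl | rfl <;> simp only [sideSum] <;> ring

lemma cross_eq (h : IsRotation T a b c) : cross T.1 T.2.1 T.2.2 = cross a b c := by
  rcases h with rfl | rfl | rfl <;> simp only [cross] <;> ring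

lemma liftVolume_eq (h : IsRotation T a b c) : liftVolume T = liftVolume (a, b, c) := by
  rcases h with rfl | rfl | rfl <;> simp only [liftVolume, cross] <;> ring

lemma mem {S : Finset ℂ} (h : IsRotation T a b c) (hT : T.1 ∈ S ∧ T.2.1 ∈ S ∧ T.2.2 ∈ S) :
    a ∈ S ∧ b ∈ S ∧ c ∈ S := by
  rcases h with rfl | rfl | rfl <;> simp_all

end IsRotation

namespace IsMesh

variable {S : Finset ℂ} {𝒯 : Multiset (ℂ × ℂ × ℂ)} {D : Multiset (ℂ × ℂ)}

/-- Stokes: twice the area of a mesh is the shoelace sum of its boundary. -/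
lemma sum_cross_eq (h : IsMesh S 𝒯 D) :
    (𝒯.map fun T => cross T.1 T.2.1 T.2.2).sum
      = (D.map fun e => e.1.re * e.2.im - e.1.im * e.2.re).sum := by
  rw [← h.boundary (fun a b => a.re * b.im - a.im * b.re) (fun a b => by ring)]
  congr 1
  refine Multiset.map_congr rfl fun T _ => ?_
  simp only [cross, sideSum]; ring

/-- Replacing one triangle by several with the same boundary. -/
lemma replace_one {T : ℂ × ℂ × ℂ} (h : IsMesh S (T ::ₘ 𝒯) D) {S' : Finset ℂ} (hS : S ⊆ S')
    {𝒰 : Multiset (ℂ × ℂ × ℂ)}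
    (hv : ∀ U ∈ 𝒰, U.1 ∈ S' ∧ U.2.1 ∈ S' ∧ U.2.2 ∈ S') (hp : ∀ U ∈ 𝒰, 0 < cross U.1 U.2.1 U.2.2)
    (hb : ∀ w : ℂ → ℂ → ℝ, (∀ a b, w a b = -w b a) → (𝒰.map (sideSum w)).sum = sideSum w T) :
    IsMesh S' (𝒰 + 𝒯) D where
  vertex_mem U hU := by
    rcases Multiset.mem_add.1 hU with hU | hU
    · exact hv U hU
    · have := h.vertex_mem U (Multiset.mem_cons_of_mem hU)
      exact ⟨hS this.1, hS this.2.1, hS this.2.2⟩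
  cross_pos U hU := by
    rcases Multiset.mem_add.1 hU with hU | hU
    · exact hp U hU
    · exact h.cross_pos U (Multiset.mem_cons_of_mem hU)
  edge_mem e he := by
    have := h.edge_mem e he
    exact ⟨hS this.1, hS this.2.1, this.2.2⟩
  boundary w hw := by
    rw [← h.boundary w hw, Multiset.map_add, Multiset.sum_add, hb w hw, Multiset.map_cons,
      Multiset.sum_cons]

/-- Replacing two triangles by several with the same boundary. -/
lemma replace_two {T T' : ℂ × ℂ × ℂ} (h : IsMesh S (T ::ₘ T' ::ₘ 𝒯) D) {S' : Finset ℂ}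
    (hS : S ⊆ S') {𝒰 : Multiset (ℂ × ℂ × ℂ)}
    (hv : ∀ U ∈ 𝒰, U.1 ∈ S' ∧ U.2.1 ∈ S' ∧ U.2.2 ∈ S') (hp : ∀ U ∈ 𝒰, 0 < cross U.1 U.2.1 U.2.2)
    (hb : ∀ w : ℂ → ℂ → ℝ, (∀ a b, w a b = -w b a) →
      (𝒰.map (sideSum w)).sum = sideSum w T + sideSum w T') :
    IsMesh S' (𝒰 + 𝒯) D where
  vertex_mem U hU := by
    rcases Multiset.mem_add.1 hU with hU | hU
    · exact hv U hU
    · have := h.vertex_mem U (Multiset.mem_cons_of_mem (Multiset.mem_cons_of_mem hU))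
      exact ⟨hS this.1, hS this.2.1, hS this.2.2⟩
  cross_pos U hU := by
    rcases Multiset.mem_add.1 hU with hU | hU
    · exact hp U hU
    · exact h.cross_pos U (Multiset.mem_cons_of_mem (Multiset.mem_cons_of_mem hU))
  edge_mem e he := by
    have := h.edge_mem e he
    exact ⟨hS this.1, hS this.2.1, this.2.2⟩
  boundary w hw := by
    rw [← h.boundary w hw, Multiset.map_add, Multiset.sum_add, hb w hw, Multiset.map_cons,
      Multiset.sum_cons, Multiset.map_cons, Multiset.sum_cons, add_assoc]

/-- Removing a triangle that has a side on the boundary. -/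
lemma remove {T : ℂ × ℂ × ℂ} {a b c : ℂ} (h : IsMesh S (T ::ₘ 𝒯) ((a, b) ::ₘ D))
    (hT : IsRotation T a b c) : IsMesh S 𝒯 ((a, c) ::ₘ (c, b) ::ₘ D) where
  vertex_mem U hU := h.vertex_mem U (Multiset.mem_cons_of_mem hU)
  cross_pos U hU := h.cross_pos U (Multiset.mem_cons_of_mem hU)
  edge_mem e he := by
    have hm := hT.mem (h.vertex_mem T (Multiset.mem_cons_self _ _))
    have hx : 0 < cross a b c := hT.cross_eq ▸ h.cross_pos T (Multiset.mem_cons_self _ _)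
    have hbc : b ≠ c := ne_of_cross_pos (c := a) (by rwa [cross_rotate])
    have hca : c ≠ a := ne_of_cross_pos (c := b) (by rwa [← cross_rotate c a b])
    rcases Multiset.mem_cons.1 he with rfl | he
    · exact ⟨hm.1, hm.2.2, hca.symm⟩
    rcases Multiset.mem_cons.1 he with rfl | he
    · exact ⟨hm.2.2, hm.2.1, hbc.symm⟩
    exact h.edge_mem e (Multiset.mem_cons_of_mem he)
  boundary w hw := by
    have := h.boundary w hw
    simp only [Multiset.map_cons, Multiset.sum_cons] at this ⊢
    rw [hT.sideSum_eq] at this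
    rw [hw a c, hw c b]
    linarith

end IsMesh

lemma exists_cons_cons {α : Type*} {s : Multiset α} {x y : α} (hx : x ∈ s) (hy : y ∈ s)
    (hxy : x ≠ y) : ∃ t, s = x ::ₘ y ::ₘ t := by
  obtain ⟨t, rfl⟩ := Multiset.exists_cons_of_mem hx
  obtain ⟨u, rfl⟩ := Multiset.exists_cons_of_mem ((Multiset.mem_cons.1 hy).resolve_left hxy.symm)
  exact ⟨u, rfl⟩

lemma not_isRotation_swap {T : ℂ × ℂ × ℂ} {a b c d : ℂ} (h : 0 < cross a b c)
    (hT : IsRotation T a b c) : ¬ IsRotation T b a d := by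
  have hab : a ≠ b := ne_of_cross_pos h
  have hbc : b ≠ c := ne_of_cross_pos (c := a) (by rwa [cross_rotate])
  have hca : c ≠ a := ne_of_cross_pos (c := b) (by rwa [← cross_rotate c a b])
  rintro h'
  rcases hT with rfl | rfl | rfl <;> rcases h' with h' | h' | h' <;>
    simp only [Prod.mk.injEq] at h' <;> grind

/-- For two triangles of a mesh on either side of an edge with opposite angles adding up to more
than `π`, exchanging the diagonal decreases the lifted volume. -/
lemma IsMesh.exists_flip {S : Finset ℂ} {𝒯 : Multiset (ℂ × ℂ × ℂ)} {D : Multiset (ℂ × ℂ)}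
    (h : IsMesh S 𝒯 D) {T T' : ℂ × ℂ × ℂ} (hT : T ∈ 𝒯) (hT' : T' ∈ 𝒯) {a b c d : ℂ}
    (hr : IsRotation T a b c) (hr' : IsRotation T' b a d)
    (hlt : cotAt a b c + cotAt b a d < 0) :
    ∃ 𝒰, IsMesh S 𝒰 D ∧ Multiset.card 𝒰 = Multiset.card 𝒯 ∧
      (𝒰.map liftVolume).sum < (𝒯.map liftVolume).sum := by
  have hc : 0 < cross a b c := hr.cross_eq ▸ h.cross_pos T hT
  have hd : 0 < cross b a d := hr'.cross_eq ▸ h.cross_pos T' hT'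
  have hm := hr.mem (h.vertex_mem T hT)
  have hm' := hr'.mem (h.vertex_mem T' hT')
  have hne : T ≠ T' := by
    rintro rfl; exact not_isRotation_swap hc hr hr'
  obtain ⟨𝒱, rfl⟩ := exists_cons_cons hT hT' hne
  have hneg : cross a b c * dotAt b a d + cross b a d * dotAt a b c < 0 := by
    unfold cotAt at hlt
    rw [div_add_div _ _ hc.ne' hd.ne', div_lt_iff₀ (mul_pos hc hd)] at hlt
    linarith
  have h1 : 0 < cross a d c := cross_pos_of_flip hc hd hneg
  have h2 : 0 < cross d b c := by
    have := cross_pos_of_flip (a := b) (b := a) (c := d) (d := c) hd hc (by linarith)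
    rwa [← cross_rotate d b c]
  refine ⟨{(a, d, c), (d, b, c)} + 𝒱, h.replace_two (Finset.Subset.refl S) ?_ ?_ ?_, ?_, ?_⟩
  · intro U hU
    simp only [Multiset.insert_eq_cons, Multiset.mem_cons, Multiset.mem_singleton] at hU
    rcases hU with rfl | rfl
    · exact ⟨hm.1, hm'.2.2, hm.2.2⟩
    · exact ⟨hm'.2.2, hm.2.1, hm.2.2⟩
  · intro U hU
    simp only [Multiset.insert_eq_cons, Multiset.mem_cons, Multiset.mem_singleton] at hU
    rcases hU with rfl | rfl
    · exact h1
    · exact h2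
  · intro w hw
    rw [hr.sideSum_eq, hr'.sideSum_eq]
    simp only [Multiset.insert_eq_cons, Multiset.map_cons, Multiset.map_singleton,
      Multiset.sum_cons, Multiset.sum_singleton, sideSum]
    rw [hw a b, hw c d]
    ring
  · simp only [Multiset.insert_eq_cons, Multiset.card_add, Multiset.card_cons,
      Multiset.card_singleton]; ring
  · simp only [Multiset.insert_eq_cons, Multiset.map_add, Multiset.map_cons,
      Multiset.map_singleton, Multiset.sum_add, Multiset.sum_cons, Multiset.sum_singleton,
      hr.liftVolume_eq, hr'.liftVolume_eq]
    have := liftVolume_flip a b c d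
    linarith

/-- Among the meshes with a given boundary and number of triangles, one has the least lifted
volume. -/
lemma IsMesh.exists_min_liftVolume {S : Finset ℂ} {𝒯 : Multiset (ℂ × ℂ × ℂ)}
    {D : Multiset (ℂ × ℂ)} (h : IsMesh S 𝒯 D) :
    ∃ 𝒰, IsMesh S 𝒰 D ∧ Multiset.card 𝒰 = Multiset.card 𝒯 ∧
      ∀ 𝒱, IsMesh S 𝒱 D → Multiset.card 𝒱 = Multiset.card 𝒯 →
        (𝒰.map liftVolume).sum ≤ (𝒱.map liftVolume).sum := by
  classical
  set n := Multiset.card 𝒯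
  have hfin : {𝒱 : Multiset (ℂ × ℂ × ℂ) | IsMesh S 𝒱 D ∧ Multiset.card 𝒱 = n}.Finite := by
    refine (Set.finite_Iic (n • (S ×ˢ S ×ˢ S).val)).subset ?_
    rintro 𝒱 ⟨hV, hn⟩
    rw [Set.mem_Iic, Multiset.le_iff_count]
    intro T
    by_cases hT : T ∈ 𝒱
    · have hm : T ∈ (S ×ˢ S ×ˢ S).val := by
        simpa [Finset.mem_product] using hV.vertex_mem T hT
      rw [Multiset.count_nsmul]
      have h1 : 1 ≤ Multiset.count T (S ×ˢ S ×ˢ S).val := Multiset.one_le_count_iff_mem.2 hm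
      calc Multiset.count T 𝒱 ≤ n := hn ▸ Multiset.count_le_card T 𝒱
        _ ≤ n * Multiset.count T (S ×ˢ S ×ˢ S).val := Nat.le_mul_of_pos_right n h1
    · rw [Multiset.count_eq_zero_of_notMem hT]; exact Nat.zero_le _
  obtain ⟨𝒰, hU, hmin⟩ := Set.exists_min_image _
    (fun 𝒱 : Multiset (ℂ × ℂ × ℂ) => (𝒱.map liftVolume).sum) hfin ⟨𝒯, h, rfl⟩
  exact ⟨𝒰, hU.1, hU.2, fun 𝒱 h1 h2 => hmin 𝒱 ⟨h1, h2⟩⟩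

/-- The least value, if negative, of the cotangents opposite to a directed edge. -/
lemma exists_negative_min_cotAt (𝒯 : Multiset (ℂ × ℂ × ℂ)) (a b : ℂ) :
    ∃ m : ℝ, m ≤ 0 ∧ (∀ T ∈ 𝒯, ∀ c, IsRotation T a b c → m ≤ cotAt a b c) ∧
      (m = 0 ∨ ∃ T ∈ 𝒯, ∃ c, IsRotation T a b c ∧ m = cotAt a b c) := by
  classical
  induction 𝒯 using Multiset.induction_on with
  | empty => exact ⟨0, le_rfl, by simp, Or.inl rfl⟩
  | cons T 𝒯 ih =>
    obtain ⟨m, hm, hle, heq⟩ := ih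
    have heq' : m = 0 ∨ ∃ U ∈ T ::ₘ 𝒯, ∃ c, IsRotation U a b c ∧ m = cotAt a b c :=
      heq.imp_right fun ⟨U, hU, h⟩ => ⟨U, Multiset.mem_cons_of_mem hU, h⟩
    by_cases hT : ∃ c, IsRotation T a b c ∧ cotAt a b c < m ∧
        ∀ c', IsRotation T a b c' → cotAt a b c ≤ cotAt a b c'
    · obtain ⟨c, hc, hlt, hmin⟩ := hT
      refine ⟨cotAt a b c, by linarith, ?_, Or.inr ⟨T, Multiset.mem_cons_self _ _, c, hc, rfl⟩⟩
      intro U hU c' hc'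
      rcases Multiset.mem_cons.1 hU with rfl | hU
      · exact hmin c' hc'
      · exact hlt.le.trans (hle U hU c' hc')
    · refine ⟨m, hm, ?_, heq'⟩
      intro U hU c hc
      rcases Multiset.mem_cons.1 hU with rfl | hU
      · by_contra hlt
        push Not at hlt
        -- the opposite vertex attaining the least cotangent among the at most three candidates
        have hfin : {c | IsRotation U a b c}.Finite := by
          refine Set.Finite.subset (Set.toFinite {U.1, U.2.1, U.2.2}) ?_
          rintro x (rfl | rfl | rfl) <;> simp
        obtain ⟨x, hx, hmin⟩ := Set.exists_min_image _ (fun x => cotAt a b x) hfin ⟨c, hc⟩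
        exact hT ⟨x, hx, (hmin c hc).trans_lt hlt, fun c' hc' => hmin c' hc'⟩
      · exact hle U hU c hc

/-- The area bound for a mesh in which the angles opposite to an inner edge add up to at most `π`
and those opposite to a boundary edge are not obtuse: the mean triangle is at least as large as the
equilateral one with side `q`. -/
lemma IsMesh.card_le_of_delaunay {S : Finset ℂ} {𝒯 : Multiset (ℂ × ℂ × ℂ)}
    {D : Multiset (ℂ × ℂ)} {q : ℝ} (hq : 0 < q)
    (hsep : ∀ a ∈ S, ∀ b ∈ S, a ≠ b → q ≤ ‖a - b‖) (h : IsMesh S 𝒯 D)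
    (hin : ∀ T ∈ 𝒯, ∀ T' ∈ 𝒯, ∀ a b c d, IsRotation T a b c → IsRotation T' b a d →
      0 ≤ cotAt a b c + cotAt b a d)
    (hbd : ∀ T ∈ 𝒯, ∀ a b c, IsRotation T a b c → (a, b) ∈ D → 0 ≤ cotAt a b c) :
    √3 * q ^ 2 * Multiset.card 𝒯 ≤ 2 * (𝒯.map fun T => cross T.1 T.2.1 T.2.2).sum := by
  have hsq : ∀ a ∈ S, ∀ b ∈ S, a ≠ b → 0 ≤ distSq a b - q ^ 2 := by
    intro a ha b hb hab
    have := hsep a ha b hb hab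
    rw [← norm_sub_sq_eq_distSq]
    nlinarith
  choose m hm0 hmle hmeq using exists_negative_min_cotAt 𝒯
  -- An antisymmetric lower bound for the cotangents, nonnegative on the boundary.
  set μ : ℂ → ℂ → ℝ := fun a b => m a b - m b a with hμ
  have hμle : ∀ T ∈ 𝒯, ∀ a b c, IsRotation T a b c → μ a b ≤ cotAt a b c := by
    intro T hT a b c hr
    rcases hmeq b a with h0 | ⟨T', hT', d, hr', hd⟩
    · simp only [hμ, h0, sub_zero]
      exact hmle a b T hT c hr
    · have h1 := hin T hT T' hT' a b c d hr hr'
      have h2 := hm0 a b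
      simp only [hμ, hd]
      linarith
  have hμD : ∀ e ∈ D, 0 ≤ μ e.1 e.2 := by
    rintro ⟨a, b⟩ he
    have h1 := hm0 b a
    rcases hmeq a b with h0 | ⟨T, hT, c, hr, hc⟩
    · simp only [hμ, h0]; linarith
    · have := hbd T hT a b c hr he
      simp only [hμ, hc]; linarith
  set w : ℂ → ℂ → ℝ := fun a b => (distSq a b - q ^ 2) * μ a b with hw
  have hanti : ∀ a b, w a b = -w b a := by
    intro a b
    simp only [hw, hμ, distSq_comm a b]; ring
  have hD : 0 ≤ (D.map fun e => w e.1 e.2).sum := by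
    refine Multiset.sum_nonneg ?_
    intro x hx
    obtain ⟨e, he, rfl⟩ := Multiset.mem_map.1 hx
    obtain ⟨h1, h2, h3⟩ := h.edge_mem e he
    exact mul_nonneg (hsq _ h1 _ h2 h3) (hμD e he)
  rw [← h.boundary w hanti] at hD
  have hle : (𝒯.map (sideSum w)).sum
      ≤ (𝒯.map fun T => 2 * cross T.1 T.2.1 T.2.2 - √3 * q ^ 2).sum := by
    refine Multiset.sum_map_le_sum_map _ _ ?_
    rintro ⟨a, b, c⟩ hT
    have hx : 0 < cross a b c := h.cross_pos _ hT
    obtain ⟨ha, hb, hc⟩ := h.vertex_mem _ hT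
    have hab : a ≠ b := ne_of_cross_pos hx
    have hbc : b ≠ c := ne_of_cross_pos (c := a) (by rwa [cross_rotate])
    have hca : c ≠ a := ne_of_cross_pos (c := b) (by rwa [← cross_rotate c a b])
    have e1 := mul_le_mul_of_nonneg_left (hμle _ hT a b c (Or.inl rfl)) (hsq a ha b hb hab)
    have e2 := mul_le_mul_of_nonneg_left (hμle _ hT b c a (Or.inr (Or.inr rfl)))
      (hsq b hb c hc hbc)
    have e3 := mul_le_mul_of_nonneg_left (hμle _ hT c a b (Or.inr (Or.inl rfl)))
      (hsq c hc a ha hca)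
    have e4 := two_mul_cross_eq_sum_cotAt hx
    have e5 := mul_le_mul_of_nonneg_left (sqrt_three_le_sum_cotAt hx) (sq_nonneg q)
    simp only [sideSum, hw]
    linarith
  rw [Multiset.sum_map_sub, Multiset.sum_map_mul_left, Multiset.map_const', Multiset.sum_replicate,
    nsmul_eq_mul] at hle
  linarith

/-- **Groemer's inequality for meshes**: with `F` triangles and `B` boundary edges on points at
mutual distance at least `q`, one has `√3 q² (F + B) ≤ 4 A + √3 q P`. -/
theorem IsMesh.card_add_card_le {S : Finset ℂ} {q : ℝ} (hq : 0 < q)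
    (hsep : ∀ a ∈ S, ∀ b ∈ S, a ≠ b → q ≤ ‖a - b‖) {𝒯 : Multiset (ℂ × ℂ × ℂ)}
    {D : Multiset (ℂ × ℂ)} (h : IsMesh S 𝒯 D) :
    √3 * q ^ 2 * (Multiset.card 𝒯 + Multiset.card D)
      ≤ 2 * (𝒯.map fun T => cross T.1 T.2.1 T.2.2).sum
        + √3 * q * (D.map fun e => ‖e.1 - e.2‖).sum := by
  induction hn : Multiset.card 𝒯 using Nat.strong_induction_on generalizing 𝒯 D with
  | _ n ih =>
  obtain ⟨𝒰, hU, hcard, hmin⟩ := h.exists_min_liftVolume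
  -- The area depends on the boundary only, so the Delaunay mesh may replace the given one.
  rw [h.sum_cross_eq, ← hU.sum_cross_eq, ← hn, ← hcard]
  have hin : ∀ T ∈ 𝒰, ∀ T' ∈ 𝒰, ∀ a b c d, IsRotation T a b c → IsRotation T' b a d →
      0 ≤ cotAt a b c + cotAt b a d := by
    intro T hT T' hT' a b c d hr hr'
    by_contra hlt
    push Not at hlt
    obtain ⟨𝒱, hV, hVc, hVlt⟩ := hU.exists_flip hT hT' hr hr' hlt
    exact absurd (hmin 𝒱 hV (hVc.trans hcard)) (not_le.2 hVlt)
  by_cases hbd : ∀ T ∈ 𝒰, ∀ a b c, IsRotation T a b c → (a, b) ∈ D → 0 ≤ cotAt a b c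
  · have h1 := hU.card_le_of_delaunay hq hsep hin hbd
    have h2 : q * Multiset.card D ≤ (D.map fun e => ‖e.1 - e.2‖).sum := by
      have : (D.map fun _ => q).sum ≤ (D.map fun e => ‖e.1 - e.2‖).sum := by
        refine Multiset.sum_map_le_sum_map _ _ fun e he => ?_
        obtain ⟨h1, h2, h3⟩ := h.edge_mem e he
        exact hsep _ h1 _ h2 h3
      rw [Multiset.map_const', Multiset.sum_replicate, nsmul_eq_mul] at this
      linarith
    have h3 := mul_le_mul_of_nonneg_left h2 (by positivity : 0 ≤ √3 * q)
    linarith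
  · push Not at hbd
    obtain ⟨T, hT, a, b, c, hr, hab, hneg⟩ := hbd
    have hx : 0 < cross a b c := hr.cross_eq ▸ hU.cross_pos T hT
    obtain ⟨ha, hb, hc⟩ := hr.mem (hU.vertex_mem T hT)
    have hbc : b ≠ c := ne_of_cross_pos (c := a) (by rwa [cross_rotate])
    have hca : c ≠ a := ne_of_cross_pos (c := b) (by rwa [← cross_rotate c a b])
    have hdot : dotAt a b c < 0 := by
      by_contra hge
      push Not at hge
      exact absurd (div_nonneg hge hx.le) (not_le.2 hneg)
    have hcut := sqrt_three_mul_excess_le_cross hq hx hdot (hsep a ha c hc hca.symm)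
      (hsep c hc b hb hbc.symm)
    obtain ⟨𝒱, rfl⟩ := Multiset.exists_cons_of_mem hT
    obtain ⟨E, rfl⟩ := Multiset.exists_cons_of_mem hab
    have hlt : Multiset.card 𝒱 < n := by
      rw [← hn, ← hcard, Multiset.card_cons]; exact Nat.lt_succ_self _
    have key := ih _ hlt (hU.remove hr) rfl
    simp only [Multiset.map_cons, Multiset.sum_cons, Multiset.card_cons, hr.cross_eq] at key ⊢
    push_cast at key ⊢
    linarith

/-! ### Inserting a point into a mesh -/

/-- The point `x` lies in the closed counterclockwise triangle `T`. -/
def InTriangle (T : ℂ × ℂ × ℂ) (x : ℂ) : Prop :=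
  0 ≤ cross T.1 T.2.1 x ∧ 0 ≤ cross T.2.1 T.2.2 x ∧ 0 ≤ cross T.2.2 T.1 x

/-- The point `x` lies in some triangle of `𝒯`. -/
def Covers (𝒯 : Multiset (ℂ × ℂ × ℂ)) (x : ℂ) : Prop := ∃ T ∈ 𝒯, InTriangle T x

lemma Covers.mono {𝒯 𝒰 : Multiset (ℂ × ℂ × ℂ)} (h : ∀ T ∈ 𝒯, T ∈ 𝒰) {x : ℂ} (hx : Covers 𝒯 x) :
    Covers 𝒰 x :=
  let ⟨T, hT, hTx⟩ := hx
  ⟨T, h T hT, hTx⟩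

lemma IsRotation.inTriangle_iff {T : ℂ × ℂ × ℂ} {a b c x : ℂ} (h : IsRotation T a b c) :
    InTriangle T x ↔ 0 ≤ cross a b x ∧ 0 ≤ cross b c x ∧ 0 ≤ cross c a x := by
  rcases h with rfl | rfl | rfl <;> simp only [InTriangle] <;> tauto

lemma eq_of_cross_eq_zero {a b c x : ℂ} (h : 0 < cross a b c) (h1 : cross a b x = 0)
    (h2 : cross b c x = 0) : x = b := by
  have hre : cross a b c * (x.re - b.re)
      = cross b c x * (a.re - b.re) + cross a b x * (c.re - b.re) := by unfold cross; ring
  have him : cross a b c * (x.im - b.im)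
      = cross b c x * (a.im - b.im) + cross a b x * (c.im - b.im) := by unfold cross; ring
  rw [h1, h2, zero_mul, zero_mul, add_zero] at hre him
  exact Complex.ext (sub_eq_zero.1 ((mul_eq_zero.1 hre).resolve_left h.ne'))
    (sub_eq_zero.1 ((mul_eq_zero.1 him).resolve_left h.ne'))

lemma IsMesh.exists_neighbour {S : Finset ℂ} {𝒯 : Multiset (ℂ × ℂ × ℂ)} {D : Multiset (ℂ × ℂ)}
    (h : IsMesh S 𝒯 D) {T : ℂ × ℂ × ℂ} (hT : T ∈ 𝒯) {a b c : ℂ} (hr : IsRotation T a b c)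
    (hD : (a, b) ∉ D) : ∃ T' ∈ 𝒯, ∃ d, IsRotation T' b a d := by
  classical
  by_contra hno
  push Not at hno
  have hab : a ≠ b := ne_of_cross_pos (c := c) (hr.cross_eq ▸ h.cross_pos T hT)
  set w : ℂ → ℂ → ℝ := fun x y =>
    (if x = a ∧ y = b then 1 else 0) - (if x = b ∧ y = a then 1 else 0) with hw
  have hanti : ∀ x y, w x y = -w y x := by
    intro x y; simp only [hw, and_comm]; ring
  have hpos : ∀ x y, ¬(x = b ∧ y = a) → 0 ≤ w x y := by
    intro x y hxy
    simp only [hw, if_neg hxy, sub_zero]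
    split_ifs <;> norm_num
  have hside : ∀ U ∈ 𝒯, 0 ≤ sideSum w U := by
    rintro ⟨x, y, z⟩ hU
    refine add_nonneg (add_nonneg ?_ ?_) ?_
    · refine hpos _ _ ?_
      rintro ⟨rfl, rfl⟩; exact hno _ hU z (Or.inl rfl)
    · refine hpos _ _ ?_
      rintro ⟨rfl, rfl⟩; exact hno _ hU x (Or.inr (Or.inr rfl))
    · refine hpos _ _ ?_
      rintro ⟨rfl, rfl⟩; exact hno _ hU y (Or.inr (Or.inl rfl))
  have hTpos : 0 < sideSum w T := by
    rw [hr.sideSum_eq]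
    have h1 : w a b = 1 := by simp [hw, hab]
    have h2 : 0 ≤ w b c := by
      refine hpos _ _ ?_
      rintro ⟨-, rfl⟩
      have : 0 < cross c b c := hr.cross_eq ▸ h.cross_pos T hT
      simp [cross] at this
    have h3 : 0 ≤ w c a := by
      refine hpos _ _ ?_
      rintro ⟨rfl, -⟩
      have : 0 < cross a c c := hr.cross_eq ▸ h.cross_pos T hT
      simp [cross, mul_comm] at this
    linarith
  have hsum : 0 < (𝒯.map (sideSum w)).sum := by
    obtain ⟨𝒱, rfl⟩ := Multiset.exists_cons_of_mem hT
    rw [Multiset.map_cons, Multiset.sum_cons]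
    refine add_pos_of_pos_of_nonneg hTpos (Multiset.sum_nonneg ?_)
    intro r hr
    obtain ⟨U, hU, rfl⟩ := Multiset.mem_map.1 hr
    exact hside U (Multiset.mem_cons_of_mem hU)
  have hneg : (D.map fun e => w e.1 e.2).sum ≤ 0 := by
    have hle : (D.map fun e => w e.1 e.2).sum ≤ (D.map fun _ => (0 : ℝ)).sum := by
      refine Multiset.sum_map_le_sum_map _ _ ?_
      rintro ⟨x, y⟩ he
      have : ¬(x = a ∧ y = b) := by rintro ⟨rfl, rfl⟩; exact hD he
      simp only [hw, if_neg this]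
      split_ifs <;> norm_num
    simpa using hle
  rw [← h.boundary w hanti] at hneg
  linarith

/-- A triangle is covered by the three triangles that an inner point `x` spans with its sides. -/
lemma covers_split_inner {a b c x y : ℂ} (h1 : 0 < cross a b x) (h2 : 0 < cross b c x)
    (h3 : 0 < cross c a x) (hab : 0 ≤ cross a b y) (hbc : 0 ≤ cross b c y)
    (hca : 0 ≤ cross c a y) : Covers {(a, b, x), (b, c, x), (c, a, x)} y := by
  have hswap : ∀ p, cross p x y = -cross x p y := fun p => by unfold cross; ring
  have hid : cross b c x * cross x a y + cross c a x * cross x b y + cross a b x * cross x c y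
      = 0 := by unfold cross; ring
  have key : (0 ≤ cross x a y ∧ cross x b y ≤ 0) ∨ (0 ≤ cross x b y ∧ cross x c y ≤ 0) ∨
      (0 ≤ cross x c y ∧ cross x a y ≤ 0) := by
    by_contra hno
    push Not at hno
    obtain ⟨n1, n2, n3⟩ := hno
    rcases le_or_gt 0 (cross x a y) with ha | ha
    · have hb := n1 ha
      have hc := n2 hb.le
      nlinarith [mul_nonneg h2.le ha, mul_pos h3 hb, mul_pos h1 hc]
    · have hc : cross x c y < 0 := by
        by_contra hc; push Not at hc; linarith [n3 hc]
      have hb : cross x b y < 0 := by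
        by_contra hb; push Not at hb; linarith [n2 hb]
      nlinarith [mul_pos h2 (neg_pos.2 ha), mul_pos h3 (neg_pos.2 hb), mul_pos h1 (neg_pos.2 hc)]
  rcases key with ⟨k1, k2⟩ | ⟨k1, k2⟩ | ⟨k1, k2⟩
  · exact ⟨(a, b, x), by simp, hab, by simp only [hswap]; linarith, k1⟩
  · exact ⟨(b, c, x), by simp, hbc, by simp only [hswap]; linarith, k1⟩
  · exact ⟨(c, a, x), by simp, hca, by simp only [hswap]; linarith, k1⟩

/-- A triangle is covered by the two parts into which a point `x` of the side `a b` cuts it. -/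
lemma covers_split_side {a b c x y : ℂ} (h1 : cross a b x = 0) (h2 : 0 < cross b c x)
    (h3 : 0 < cross c a x) (hab : 0 ≤ cross a b y) (hbc : 0 ≤ cross b c y)
    (hca : 0 ≤ cross c a y) : Covers {(b, c, x), (c, a, x)} y := by
  have hswap : ∀ p, cross p x y = -cross x p y := fun p => by unfold cross; ring
  have hX : cross a b c = cross a b x + cross b c x + cross c a x := by unfold cross; ring
  have hX0 : 0 < cross a b c := by linarith
  have hb : 0 ≤ cross x b y := by
    have : cross a b c * cross x b y = cross b c x * cross a b y + cross a b x * cross c b y := by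
      unfold cross; ring
    rw [h1, zero_mul, add_zero] at this
    exact nonneg_of_mul_nonneg_right (this ▸ mul_nonneg h2.le hab) hX0
  have ha : 0 ≤ -cross x a y := by
    have : cross a b c * (-cross x a y)
        = cross c a x * cross a b y + cross a b x * cross a c y := by
      unfold cross; ring
    rw [h1, zero_mul, add_zero] at this
    exact nonneg_of_mul_nonneg_right (this ▸ mul_nonneg h3.le hab) hX0
  rcases le_total (cross x c y) 0 with hc | hc
  · exact ⟨(b, c, x), by simp, hbc, by simp only [hswap]; linarith, hb⟩
  · exact ⟨(c, a, x), by simp, hca, by simp only [hswap]; linarith, hc⟩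

lemma cross_pos_of_mem_side {a b c d x : ℂ} (hd : 0 < cross b a d) (h1 : cross a b x = 0)
    (h2 : 0 < cross b c x) (h3 : 0 < cross c a x) : 0 < cross a d x ∧ 0 < cross d b x := by
  have hX : cross a b c = cross a b x + cross b c x + cross c a x := by unfold cross; ring
  have hX0 : 0 < cross a b c := by linarith
  have e1 : cross a b c * cross a d x = cross c a x * cross b a d + cross a b x * cross a d c := by
    unfold cross; ring
  have e2 : cross a b c * cross d b x = cross b c x * cross b a d + cross a b x * cross d b c := by
    unfold cross; ring
  rw [h1, zero_mul, add_zero] at e1 e2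
  exact ⟨pos_of_mul_pos_right (e1 ▸ mul_pos h3 hd) hX0.le,
    pos_of_mul_pos_right (e2 ▸ mul_pos h2 hd) hX0.le⟩

namespace IsMesh

variable {S : Finset ℂ} {𝒯 : Multiset (ℂ × ℂ × ℂ)} {D : Multiset (ℂ × ℂ)}

lemma insert_inner (h : IsMesh S 𝒯 D) {T : ℂ × ℂ × ℂ} (hT : T ∈ 𝒯) {a b c x : ℂ}
    (hr : IsRotation T a b c) (h1 : 0 < cross a b x) (h2 : 0 < cross b c x)
    (h3 : 0 < cross c a x) :
    ∃ 𝒰, IsMesh (insert x S) 𝒰 D ∧ Multiset.card 𝒰 = Multiset.card 𝒯 + 2 ∧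
      ∀ y, Covers 𝒯 y → Covers 𝒰 y := by
  obtain ⟨ha, hb, hc⟩ := hr.mem (h.vertex_mem T hT)
  obtain ⟨𝒱, rfl⟩ := Multiset.exists_cons_of_mem hT
  refine ⟨{(a, b, x), (b, c, x), (c, a, x)} + 𝒱,
    h.replace_one (Finset.subset_insert _ _) ?_ ?_ ?_, ?_, ?_⟩
  · simp [ha, hb, hc]
  · simp [h1, h2, h3]
  · intro w hw
    rw [hr.sideSum_eq]
    simp only [Multiset.insert_eq_cons, Multiset.map_cons, Multiset.map_singleton,
      Multiset.sum_cons, Multiset.sum_singleton, sideSum]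
    rw [hw x a, hw x b, hw x c]
    ring
  · simp only [Multiset.insert_eq_cons, Multiset.card_add, Multiset.card_cons,
      Multiset.card_singleton]; ring
  · rintro y ⟨U, hU, hy⟩
    rcases Multiset.mem_cons.1 hU with rfl | hU
    · obtain ⟨y1, y2, y3⟩ := hr.inTriangle_iff.1 hy
      exact (covers_split_inner h1 h2 h3 y1 y2 y3).mono
        fun V hV => Multiset.mem_add.2 (Or.inl hV)
    · exact ⟨U, Multiset.mem_add.2 (Or.inr hU), hy⟩

lemma insert_side (h : IsMesh S 𝒯 D) {T : ℂ × ℂ × ℂ} (hT : T ∈ 𝒯) {a b c x : ℂ}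
    (hr : IsRotation T a b c) (hD : ∀ e ∈ D, 0 < cross e.1 e.2 x) (h1 : cross a b x = 0)
    (h2 : 0 < cross b c x) (h3 : 0 < cross c a x) :
    ∃ 𝒰, IsMesh (insert x S) 𝒰 D ∧ Multiset.card 𝒰 = Multiset.card 𝒯 + 2 ∧
      ∀ y, Covers 𝒯 y → Covers 𝒰 y := by
  obtain ⟨T', hT', d, hr'⟩ := h.exists_neighbour hT hr fun he => (hD _ he).ne' h1
  obtain ⟨ha, hb, hc⟩ := hr.mem (h.vertex_mem T hT)
  obtain ⟨-, -, hd⟩ := hr'.mem (h.vertex_mem T' hT')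
  have hX : 0 < cross a b c := hr.cross_eq ▸ h.cross_pos T hT
  obtain ⟨h4, h5⟩ := cross_pos_of_mem_side (hr'.cross_eq ▸ h.cross_pos T' hT') h1 h2 h3
  have h1' : cross b a x = 0 := by
    rw [← neg_eq_zero, ← h1]; unfold cross; ring
  have hne : T ≠ T' := by
    rintro rfl; exact not_isRotation_swap hX hr hr'
  obtain ⟨𝒱, rfl⟩ := exists_cons_cons hT hT' hne
  refine ⟨({(b, c, x), (c, a, x)} + {(a, d, x), (d, b, x)}) + 𝒱,
    h.replace_two (Finset.subset_insert _ _) ?_ ?_ ?_, ?_, ?_⟩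
  · simp [ha, hb, hc, hd]
  · simp [h2, h3, h4, h5]
  · intro w hw
    rw [hr.sideSum_eq, hr'.sideSum_eq]
    simp only [Multiset.insert_eq_cons, Multiset.map_cons, Multiset.map_singleton,
      Multiset.map_add, Multiset.sum_add, Multiset.sum_cons, Multiset.sum_singleton, sideSum]
    rw [hw x a, hw x b, hw x c, hw x d, hw b a]
    ring
  · simp only [Multiset.insert_eq_cons, Multiset.card_add, Multiset.card_cons,
      Multiset.card_singleton]; ring
  · rintro y ⟨U, hU, hy⟩
    rcases Multiset.mem_cons.1 hU with rfl | hU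
    · obtain ⟨y1, y2, y3⟩ := hr.inTriangle_iff.1 hy
      exact (covers_split_side h1 h2 h3 y1 y2 y3).mono
        fun V hV => Multiset.mem_add.2 (Or.inl (Multiset.mem_add.2 (Or.inl hV)))
    rcases Multiset.mem_cons.1 hU with rfl | hU
    · obtain ⟨y1, y2, y3⟩ := hr'.inTriangle_iff.1 hy
      exact (covers_split_side h1' h4 h5 y1 y2 y3).mono
        fun V hV => Multiset.mem_add.2 (Or.inl (Multiset.mem_add.2 (Or.inr hV)))
    · exact ⟨U, Multiset.mem_add.2 (Or.inr hU), hy⟩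

/-- A point strictly to the left of all boundary edges that is covered by a mesh can be made one of
its vertices, at the cost of two more triangles. -/
lemma exists_insert (h : IsMesh S 𝒯 D) {x : ℂ} (hx : x ∉ S)
    (hD : ∀ e ∈ D, 0 < cross e.1 e.2 x) (hcov : Covers 𝒯 x) :
    ∃ 𝒰, IsMesh (insert x S) 𝒰 D ∧ Multiset.card 𝒰 = Multiset.card 𝒯 + 2 ∧
      ∀ y, Covers 𝒯 y → Covers 𝒰 y := by
  obtain ⟨⟨a, b, c⟩, hT, h1, h2, h3⟩ := hcov
  dsimp only at h1 h2 h3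
  obtain ⟨ha, hb, hc⟩ := h.vertex_mem _ hT
  have hX : 0 < cross a b c := h.cross_pos _ hT
  have hX2 : 0 < cross b c a := by rwa [cross_rotate]
  have hX3 : 0 < cross c a b := by rwa [cross_rotate]
  -- Two vanishing orientations would make `x` a vertex.
  have n12 : cross a b x = 0 → cross b c x ≠ 0 := fun e1 e2 =>
    hx (eq_of_cross_eq_zero hX e1 e2 ▸ hb)
  have n23 : cross b c x = 0 → cross c a x ≠ 0 := fun e1 e2 =>
    hx (eq_of_cross_eq_zero hX2 e1 e2 ▸ hc)
  have n31 : cross c a x = 0 → cross a b x ≠ 0 := fun e1 e2 =>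
    hx (eq_of_cross_eq_zero hX3 e1 e2 ▸ ha)
  rcases h1.eq_or_lt with e1 | p1
  · exact h.insert_side hT (Or.inl rfl) hD e1.symm (h2.lt_of_ne' (n12 e1.symm))
      (h3.lt_of_ne' fun e => n31 e e1.symm)
  rcases h2.eq_or_lt with e2 | p2
  · exact h.insert_side hT (Or.inr (Or.inr rfl)) hD e2.symm (h3.lt_of_ne' (n23 e2.symm)) p1
  rcases h3.eq_or_lt with e3 | p3
  · exact h.insert_side hT (Or.inr (Or.inl rfl)) hD e3.symm p1 p2
  exact h.insert_inner hT (Or.inl rfl) p1 p2 p3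

lemma exists_insert_finset (h : IsMesh S 𝒯 D) (I : Finset ℂ) (hI : Disjoint S I)
    (hD : ∀ x ∈ I, ∀ e ∈ D, 0 < cross e.1 e.2 x) (hcov : ∀ x ∈ I, Covers 𝒯 x) :
    ∃ 𝒰, IsMesh (S ∪ I) 𝒰 D ∧ Multiset.card 𝒰 = Multiset.card 𝒯 + 2 * I.card := by
  induction I using Finset.induction_on generalizing S 𝒯 with
  | empty => exact ⟨𝒯, by simpa using h, by simp⟩
  | insert x I hxI ih =>
    rw [Finset.disjoint_insert_right] at hI
    obtain ⟨𝒰, hU, hcard, hc⟩ := h.exists_insert hI.1 (hD x (Finset.mem_insert_self _ _))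
      (hcov x (Finset.mem_insert_self _ _))
    obtain ⟨𝒱, hV, hcard'⟩ := ih hU (Finset.disjoint_insert_left.2 ⟨hxI, hI.2⟩)
      (fun y hy => hD y (Finset.mem_insert_of_mem hy))
      (fun y hy => hc y (hcov y (Finset.mem_insert_of_mem hy)))
    refine ⟨𝒱, ?_, ?_⟩
    · rwa [Finset.insert_union, ← Finset.union_insert] at hV
    · rw [hcard', hcard, Finset.card_insert_of_notMem hxI]; ring

end IsMesh

/-! ### The fan of a convex polygon -/

/-- The triangles that the vertex `v 0` of the polygon `v 0, …, v (n + 1)` spans with the sides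
that do not contain it. -/
def fan (v : ℕ → ℂ) (n : ℕ) : Multiset (ℂ × ℂ × ℂ) :=
  (Multiset.range n).map fun i => (v 0, v (i + 1), v (i + 2))

/-- The directed path `v 0, v 1, …, v n`. -/
def pathEdges (v : ℕ → ℂ) (n : ℕ) : Multiset (ℂ × ℂ) :=
  (Multiset.range n).map fun i => (v i, v (i + 1))

lemma isMesh_fan {S : Finset ℂ} {v : ℕ → ℂ} {n : ℕ} (hv : ∀ i < n + 2, v i ∈ S)
    (hclosed : v (n + 2) = v 0) (hne : ∀ i < n + 2, v i ≠ v (i + 1))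
    (hpos : ∀ i < n, 0 < cross (v 0) (v (i + 1)) (v (i + 2))) :
    IsMesh S (fan v n) (pathEdges v (n + 2)) where
  vertex_mem T hT := by
    obtain ⟨i, hi, rfl⟩ := Multiset.mem_map.1 hT
    rw [Multiset.mem_range] at hi
    exact ⟨hv _ (by omega), hv _ (by omega), hv _ (by omega)⟩
  cross_pos T hT := by
    obtain ⟨i, hi, rfl⟩ := Multiset.mem_map.1 hT
    exact hpos i (Multiset.mem_range.1 hi)
  edge_mem e he := by
    obtain ⟨i, hi, rfl⟩ := Multiset.mem_map.1 he
    rw [Multiset.mem_range] at hi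
    refine ⟨hv i hi, ?_, hne i hi⟩
    rcases (Nat.succ_le_of_lt hi).eq_or_lt with h | h
    · have : i + 1 = n + 2 := h
      simp only [this, hclosed]; exact hv 0 (by omega)
    · exact hv _ h
  boundary w hw := by
    have key : ∀ m, ((fan v m).map (sideSum w)).sum
        = ((pathEdges v (m + 1)).map fun e => w e.1 e.2).sum + w (v (m + 1)) (v 0) := by
      intro m
      induction m with
      | zero =>
        simp [fan, pathEdges, hw (v 1) (v 0)]
      | succ m ih =>
        simp only [fan, pathEdges, Multiset.range_succ (m + 1), Multiset.range_succ m,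
          Multiset.map_cons, Multiset.sum_cons, sideSum, Multiset.map_map,
          Function.comp_def] at ih ⊢
        rw [ih, hw (v 0)]
        ring
    rw [key n, ← hclosed]
    simp only [pathEdges, Multiset.range_succ (n + 1), Multiset.map_cons, Multiset.sum_cons]
    ring

lemma covers_fan {v : ℕ → ℂ} {n : ℕ} (hclosed : v (n + 2) = v 0) {x : ℂ}
    (hx : ∀ i < n + 2, 0 < cross (v i) (v (i + 1)) x) : Covers (fan v n) x := by
  have hswap : ∀ i, cross (v i) (v 0) x = -cross (v 0) (v i) x := fun i => by unfold cross; ring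
  -- A change of sign of `cross (v 0) (v i) x` tells the triangle that contains `x`.
  have key : ∃ i < n, 0 ≤ cross (v 0) (v (i + 1)) x ∧ cross (v 0) (v (i + 2)) x ≤ 0 := by
    by_contra hno
    push Not at hno
    have hall : ∀ i ≤ n, 0 < cross (v 0) (v (i + 1)) x := by
      intro i
      induction i with
      | zero => intro _; exact hx 0 (by omega)
      | succ i ih => intro hi; exact hno i (by omega) (ih (by omega)).le
    have h1 := hall n le_rfl
    have h2 := hx (n + 1) (by omega)
    rw [hclosed, hswap] at h2
    linarith
  obtain ⟨i, hi, h1, h2⟩ := key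
  refine ⟨_, Multiset.mem_map.2 ⟨i, Multiset.mem_range.2 hi, rfl⟩, h1,
    (hx (i + 1) (by omega)).le, ?_⟩
  change 0 ≤ cross (v (i + 2)) (v 0) x
  rw [hswap]; linarith

/-! ### Moving points to the circle -/

/-- The inner product of the plane. -/
def planeInner (d x : ℂ) : ℝ := d.re * x.re + d.im * x.im

/-- A finite set of points of the closed unit disk with mutual distances at least `q`. -/
structure IsSeparatedInDisk (q : ℝ) (V : Finset ℂ) : Prop where
  norm_le : ∀ x ∈ V, ‖x‖ ≤ 1
  sep : ∀ x ∈ V, ∀ y ∈ V, x ≠ y → q ≤ ‖x - y‖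

/-- A point of the set that maximizes a linear functional can be moved to the circle, in the
direction of the functional: this increases the distances to all other points. -/
lemma IsSeparatedInDisk.exists_move {q : ℝ} (hq : 0 < q) {V : Finset ℂ}
    (h : IsSeparatedInDisk q V) {d v : ℂ} (hd : d ≠ 0) (hv : v ∈ V) (hv1 : ‖v‖ ≠ 1)
    (hmax : ∀ x ∈ V, planeInner d x ≤ planeInner d v) :
    ∃ W, IsSeparatedInDisk q W ∧ W.card = V.card ∧
      (V.filter fun x => ‖x‖ = 1).card < (W.filter fun x => ‖x‖ = 1).card := by
  have hvlt : ‖v‖ < 1 := lt_of_le_of_ne (h.norm_le v hv) hv1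
  obtain ⟨t, ht, ht1⟩ : ∃ t : ℝ, 0 ≤ t ∧ ‖v + t * d‖ = 1 := by
    have hcont : Continuous fun t : ℝ => ‖v + t * d‖ := by fun_prop
    have hdn : 0 < ‖d‖ := norm_pos_iff.2 hd
    have hT : 0 ≤ 2 / ‖d‖ := by positivity
    have hbig : 1 ≤ ‖v + ((2 / ‖d‖ : ℝ) : ℂ) * d‖ := by
      have h1 : ‖((2 / ‖d‖ : ℝ) : ℂ) * d‖ = 2 := by
        rw [norm_mul, Complex.norm_real, Real.norm_of_nonneg hT]; field_simp
      have h2 := norm_sub_le (v + ((2 / ‖d‖ : ℝ) : ℂ) * d) v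
      rw [add_sub_cancel_left, h1] at h2
      linarith
    obtain ⟨t, ht, ht1⟩ := intermediate_value_Icc hT hcont.continuousOn
      (⟨by simpa using hvlt.le, hbig⟩ : (1 : ℝ) ∈ Set.Icc _ _)
    exact ⟨t, ht.1, ht1⟩
  set v' : ℂ := v + t * d with hv'
  have hfar : ∀ x ∈ V, x ≠ v → q ≤ ‖v' - x‖ := by
    intro x hx hxv
    refine (h.sep v hv x hx hxv.symm).trans ?_
    refine abs_le_of_sq_le_sq' ?_ (norm_nonneg _) |>.2
    have hm := mul_nonneg ht (sub_nonneg.2 (hmax x hx))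
    rw [norm_sub_sq_eq_distSq, norm_sub_sq_eq_distSq]
    have : distSq v' x = distSq v x + 2 * (t * (planeInner d v - planeInner d x))
        + t ^ 2 * (d.re ^ 2 + d.im ^ 2) := by
      simp only [hv', distSq, planeInner, Complex.add_re, Complex.add_im, Complex.mul_re,
        Complex.mul_im, Complex.ofReal_re, Complex.ofReal_im]
      ring
    have : 0 ≤ t ^ 2 * (d.re ^ 2 + d.im ^ 2) := by positivity
    linarith
  have hnot : v' ∉ V.erase v := by
    intro hmem
    have := hfar v' (Finset.mem_of_mem_erase hmem) (Finset.ne_of_mem_erase hmem)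
    simp at this; linarith
  refine ⟨insert v' (V.erase v), ⟨?_, ?_⟩, ?_, ?_⟩
  · intro x hx
    rcases Finset.mem_insert.1 hx with rfl | hx
    · exact ht1.le
    · exact h.norm_le x (Finset.mem_of_mem_erase hx)
  · intro x hx y hy hxy
    rcases Finset.mem_insert.1 hx with rfl | hx <;> rcases Finset.mem_insert.1 hy with rfl | hy
    · exact absurd rfl hxy
    · exact hfar y (Finset.mem_of_mem_erase hy) (Finset.ne_of_mem_erase hy)
    · rw [norm_sub_rev]
      exact hfar x (Finset.mem_of_mem_erase hx) (Finset.ne_of_mem_erase hx)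
    · exact h.sep x (Finset.mem_of_mem_erase hx) y (Finset.mem_of_mem_erase hy) hxy
  · rw [Finset.card_insert_of_notMem hnot, Finset.card_erase_add_one hv]
  · rw [Finset.filter_insert, if_pos ht1, Finset.card_insert_of_notMem
      (fun hm => hnot (Finset.mem_of_mem_filter _ hm))]
    refine Nat.lt_succ_of_le (Finset.card_le_card ?_)
    intro x hx
    rw [Finset.mem_filter] at hx ⊢
    exact ⟨Finset.mem_erase.2 ⟨fun e => hv1 (e ▸ hx.2), hx.1⟩, hx.2⟩

/-- All extreme points of the set lie on the unit circle. -/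
def ExtremePointsOnCircle (V : Finset ℂ) : Prop :=
  ∀ d : ℂ, d ≠ 0 → ∀ v ∈ V, (∀ x ∈ V, planeInner d x ≤ planeInner d v) → ‖v‖ = 1

lemma IsSeparatedInDisk.exists_extremePointsOnCircle {q : ℝ} (hq : 0 < q) {V : Finset ℂ}
    (h : IsSeparatedInDisk q V) :
    ∃ W, IsSeparatedInDisk q W ∧ W.card = V.card ∧ ExtremePointsOnCircle W := by
  induction hn : V.card - (V.filter fun x => ‖x‖ = 1).card using Nat.strong_induction_on
    generalizing V with
  | _ n ih =>
  by_cases hV : ExtremePointsOnCircle V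
  · exact ⟨V, h, rfl, hV⟩
  · simp only [ExtremePointsOnCircle] at hV
    push Not at hV
    obtain ⟨d, hd, v, hv, hmax, hv1⟩ := hV
    obtain ⟨W, hW, hcard, hlt⟩ := h.exists_move hq hd hv hv1 hmax
    have hle : (W.filter fun x => ‖x‖ = 1).card ≤ W.card := Finset.card_filter_le _ _
    obtain ⟨U, hU, hUc, hUe⟩ := ih _ (by omega) hW rfl
    exact ⟨U, hU, hUc.trans hcard, hUe⟩

/-! ### Points on the circle in cyclic order -/

/-- The point of the unit circle with polar angle `t`. -/
noncomputable def circlePoint (t : ℝ) : ℂ := ⟨Real.cos t, Real.sin t⟩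

lemma norm_circlePoint (t : ℝ) : ‖circlePoint t‖ = 1 := by
  rw [← sq_eq_sq₀ (norm_nonneg _) zero_le_one, Complex.sq_norm, Complex.normSq_apply]
  simp only [circlePoint]
  nlinarith [Real.sin_sq_add_cos_sq t]

lemma circlePoint_arg {x : ℂ} (hx : ‖x‖ = 1) : circlePoint x.arg = x := by
  have h := Complex.norm_mul_cos_add_sin_mul_I x
  rw [hx, Complex.ofReal_one, one_mul, ← Complex.ofReal_cos, ← Complex.ofReal_sin] at h
  conv_rhs => rw [← h]
  apply Complex.ext <;> simp [circlePoint, -Complex.ofReal_cos, -Complex.ofReal_sin]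

lemma circlePoint_add_two_pi (t : ℝ) : circlePoint (t + 2 * Real.pi) = circlePoint t := by
  simp [circlePoint]

lemma planeInner_circlePoint (s t : ℝ) :
    planeInner (circlePoint s) (circlePoint t) = Real.cos (t - s) := by
  simp only [planeInner, circlePoint, Real.cos_sub]; ring

/-- A finite set of points on the unit circle is the set of `circlePoint (θ i)` for an increasing
sequence of angles `θ 0 < … < θ k = θ 0 + 2π`. -/
lemma exists_angles {C : Finset ℂ} (hC : ∀ x ∈ C, ‖x‖ = 1) (hne : C.Nonempty) :
    ∃ θ : ℕ → ℝ, θ C.card = θ 0 + 2 * Real.pi ∧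
      (∀ i j, i < j → j ≤ C.card → θ i < θ j) ∧
      (∀ i < C.card, circlePoint (θ i) ∈ C) ∧
      ∀ x ∈ C, ∃ i < C.card, x = circlePoint (θ i) := by
  classical
  have hinj : Set.InjOn Complex.arg C := by
    intro x hx y hy hxy
    rw [← circlePoint_arg (hC x hx), hxy, circlePoint_arg (hC y hy)]
  have hcard : (C.image Complex.arg).card = C.card := Finset.card_image_of_injOn hinj
  set k := C.card with hk
  have hk0 : 0 < k := Finset.card_pos.2 hne
  set f := (C.image Complex.arg).orderEmbOfFin hcard with hf
  have hfmem : ∀ i, ∃ x ∈ C, x.arg = f i := fun i =>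
    Finset.mem_image.1 (Finset.orderEmbOfFin_mem (C.image Complex.arg) hcard i)
  refine ⟨fun i => if h : i < k then f ⟨i, h⟩ else f ⟨0, hk0⟩ + 2 * Real.pi, ?_, ?_, ?_, ?_⟩
  · simp [hk0]
  · intro i j hij hj
    have hi : i < k := by omega
    rcases hj.eq_or_lt with rfl | hj
    · simp only [hi, lt_irrefl, dif_pos, dif_neg, not_false_eq_true]
      obtain ⟨x, -, hx⟩ := hfmem ⟨i, hi⟩
      obtain ⟨y, -, hy⟩ := hfmem ⟨0, hk0⟩
      rw [← hx, ← hy]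
      linarith [Complex.arg_le_pi x, Complex.neg_pi_lt_arg y]
    · simp only [hi, hj, dif_pos]
      exact f.strictMono hij
  · intro i hi
    simp only [hi, dif_pos]
    obtain ⟨x, hx, hxe⟩ := hfmem ⟨i, hi⟩
    rw [← hxe, circlePoint_arg (hC x hx)]
    exact hx
  · intro x hx
    have hm : x.arg ∈ Set.range f := by
      rw [hf, Finset.range_orderEmbOfFin]
      exact Finset.mem_coe.2 (Finset.mem_image_of_mem _ hx)
    obtain ⟨⟨i, hi⟩, hie⟩ := hm
    refine ⟨i, hi, ?_⟩
    simp only [hi, dif_pos]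
    rw [hie, circlePoint_arg (hC x hx)]

lemma cross_circlePoint_left (s t : ℝ) (x : ℂ) :
    cross (circlePoint s) (circlePoint t) x = 2 * Real.sin ((t - s) / 2)
      * (Real.cos ((t - s) / 2) - planeInner (circlePoint ((s + t) / 2)) x) := by
  obtain ⟨m, hm⟩ : ∃ m, m = (s + t) / 2 := ⟨_, rfl⟩
  obtain ⟨u, hu⟩ : ∃ u, u = (t - s) / 2 := ⟨_, rfl⟩
  have hs : s = m - u := by rw [hm, hu]; ring
  have ht : t = m + u := by rw [hm, hu]; ring
  rw [← hm, ← hu, hs, ht]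
  simp only [cross, planeInner, circlePoint, Real.cos_add, Real.sin_add, Real.cos_sub,
    Real.sin_sub]
  linear_combination (2 * Real.sin u * Real.cos u) * Real.sin_sq_add_cos_sq m

lemma cross_circlePoint_pos {r s t : ℝ} (h1 : r < s) (h2 : s < t) (h3 : t < r + 2 * Real.pi) :
    0 < cross (circlePoint r) (circlePoint s) (circlePoint t) := by
  rw [cross_circlePoint_left, planeInner_circlePoint]
  have hs : 0 < Real.sin ((s - r) / 2) :=
    Real.sin_pos_of_pos_of_lt_pi (by linarith) (by linarith)
  have hs2 : 0 < Real.sin ((t - r) / 2) :=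
    Real.sin_pos_of_pos_of_lt_pi (by linarith) (by linarith)
  have hs3 : 0 < Real.sin ((t - s) / 2) :=
    Real.sin_pos_of_pos_of_lt_pi (by linarith) (by linarith)
  rw [Real.cos_sub_cos]
  have e1 : ((s - r) / 2 + (t - (r + s) / 2)) / 2 = (t - r) / 2 := by ring
  have e2 : ((s - r) / 2 - (t - (r + s) / 2)) / 2 = -((t - s) / 2) := by ring
  rw [e1, e2, Real.sin_neg]
  have := mul_pos hs (mul_pos hs2 hs3)
  linarith

lemma norm_circlePoint_sub {s t : ℝ} (h : s ≤ t) (h' : t ≤ s + 2 * Real.pi) :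
    ‖circlePoint s - circlePoint t‖ = 2 * Real.sin ((t - s) / 2) := by
  have h0 : 0 ≤ Real.sin ((t - s) / 2) :=
    Real.sin_nonneg_of_nonneg_of_le_pi (by linarith) (by linarith)
  rw [← sq_eq_sq₀ (norm_nonneg _) (by positivity), norm_sub_sq_eq_distSq, mul_pow,
    Real.sin_sq_eq_half_sub]
  have : 2 * ((t - s) / 2) = t - s := by ring
  rw [this, Real.cos_sub]
  simp only [distSq, circlePoint]
  linear_combination Real.sin_sq_add_cos_sq s + Real.sin_sq_add_cos_sq t

/-- If all extreme points lie on the circle, the other points lie strictly to the left of each side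
of the polygon formed by the points on the circle. -/
lemma cross_pos_of_norm_ne_one {V : Finset ℂ} (hV : ExtremePointsOnCircle V) {θ : ℕ → ℝ} {k : ℕ}
    (hk : 2 ≤ k) (hper : θ k = θ 0 + 2 * Real.pi) (hmono : ∀ i j, i < j → j ≤ k → θ i < θ j)
    (hcirc : ∀ x ∈ V, ‖x‖ = 1 → ∃ i < k, x = circlePoint (θ i)) {i : ℕ} (hi : i < k) {x : ℂ}
    (hx : x ∈ V) (hx1 : ‖x‖ ≠ 1) :
    0 < cross (circlePoint (θ i)) (circlePoint (θ (i + 1))) x := by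
  have hmono' : ∀ i j, i ≤ j → j ≤ k → θ i ≤ θ j := fun i j hij hj => by
    rcases hij.eq_or_lt with rfl | h
    · exact le_rfl
    · exact (hmono i j h hj).le
  have h1 : θ i < θ (i + 1) := hmono _ _ (Nat.lt_succ_self i) hi
  have h2 : θ (i + 1) < θ i + 2 * Real.pi := by
    rcases Nat.eq_zero_or_pos i with rfl | hi0
    · rw [← hper]; exact hmono _ _ (by omega) le_rfl
    · have := hmono 0 i hi0 hi.le
      have := hmono' (i + 1) k hi le_rfl
      linarith
  rw [cross_circlePoint_left]
  set d := circlePoint ((θ i + θ (i + 1)) / 2) with hd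
  have hd0 : d ≠ 0 := norm_pos_iff.1 (by rw [hd, norm_circlePoint]; exact one_pos)
  refine mul_pos (mul_pos two_pos
    (Real.sin_pos_of_pos_of_lt_pi (by linarith) (by linarith))) (sub_pos.2 ?_)
  obtain ⟨m, hm, hmax⟩ := V.exists_max_image (planeInner d) ⟨x, hx⟩
  obtain ⟨j, hj, hmj⟩ := hcirc m hm (hV d hd0 m hm hmax)
  have hmle : planeInner d m ≤ Real.cos ((θ (i + 1) - θ i) / 2) := by
    rw [hmj, hd, planeInner_circlePoint]
    rcases Nat.lt_or_ge i j with hij | hij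
    · have e1 := hmono' (i + 1) j hij hj.le
      have e2 := hmono j k hj le_rfl
      have e3 := hmono' 0 i (Nat.zero_le i) hi.le
      rcases le_total (θ j - (θ i + θ (i + 1)) / 2) Real.pi with h | h
      · exact Real.cos_le_cos_of_nonneg_of_le_pi (by linarith) h (by linarith)
      · rw [← Real.cos_two_pi_sub]
        exact Real.cos_le_cos_of_nonneg_of_le_pi (by linarith) (by linarith) (by linarith)
    · have e1 := hmono' j i hij hi.le
      have e2 := hmono' 0 j (Nat.zero_le j) hj.le
      have e3 := hmono' (i + 1) k hi le_rfl
      rw [← Real.cos_neg]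
      rcases le_total (-(θ j - (θ i + θ (i + 1)) / 2)) Real.pi with h | h
      · exact Real.cos_le_cos_of_nonneg_of_le_pi (by linarith) h (by linarith)
      · rw [← Real.cos_two_pi_sub]
        exact Real.cos_le_cos_of_nonneg_of_le_pi (by linarith) (by linarith) (by linarith)
  refine lt_of_le_of_ne ((hmax x hx).trans hmle) fun heq => ?_
  exact hx1 (hV d hd0 x hx fun y hy => (hmax y hy).trans (hmle.trans heq.ge))

lemma two_le_card_circle {V : Finset ℂ} (h1 : ∀ x ∈ V, ‖x‖ ≤ 1) (hV : ExtremePointsOnCircle V)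
    (hcard : 2 ≤ V.card) : 2 ≤ (V.filter fun x => ‖x‖ = 1).card := by
  have hne : V.Nonempty := Finset.card_pos.1 (by omega)
  obtain ⟨v, hv, hvmax⟩ := V.exists_max_image (planeInner 1) hne
  have hv1 := hV 1 one_ne_zero v hv hvmax
  have hv0 : -v ≠ 0 := neg_ne_zero.2 (norm_pos_iff.1 (by rw [hv1]; exact one_pos))
  obtain ⟨u, hu, humax⟩ := V.exists_max_image (planeInner (-v)) hne
  have hu1 := hV _ hv0 u hu humax
  refine Finset.one_lt_card.2 ⟨v, by simp [hv, hv1], u, by simp [hu, hu1], ?_⟩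
  rintro rfl
  -- The point `v` would minimize and maximize the functional, so all points would coincide.
  obtain ⟨x, hx, hxv⟩ := Finset.exists_mem_ne (by omega : 1 < V.card) v
  have e1 := humax x hx
  have e2 : v.re ^ 2 + v.im ^ 2 = 1 := by
    have := norm_sub_sq_eq_distSq v 0
    simp only [sub_zero, hv1, distSq, Complex.zero_re, Complex.zero_im] at this
    linarith
  have e3 : x.re ^ 2 + x.im ^ 2 ≤ 1 := by
    have := norm_sub_sq_eq_distSq x 0
    simp only [sub_zero, distSq, Complex.zero_re, Complex.zero_im] at this
    nlinarith [h1 x hx, norm_nonneg x]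
  simp only [planeInner, Complex.neg_re, Complex.neg_im] at e1
  have hre : x.re - v.re = 0 := by nlinarith [sq_nonneg (x.re - v.re), sq_nonneg (x.im - v.im)]
  have him : x.im - v.im = 0 := by nlinarith [sq_nonneg (x.re - v.re), sq_nonneg (x.im - v.im)]
  exact hxv (Complex.ext (sub_eq_zero.1 hre) (sub_eq_zero.1 him))

/-! ### Counting separated points in the disk -/

lemma mul_sin_le_mul_sin {s t : ℝ} (hs : 0 < s) (hst : s ≤ t) (ht : t ≤ Real.pi) :
    s * Real.sin t ≤ t * Real.sin s := by
  have ht0 : 0 < t := hs.trans_le hst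
  have h := strictConcaveOn_sin_Icc.concaveOn.2 (x := 0) (y := t) ⟨le_rfl, Real.pi_pos.le⟩
    ⟨ht0.le, ht⟩ (sub_nonneg.2 ((div_le_one ht0).2 hst)) (div_nonneg hs.le ht0.le) (by ring)
  simp only [smul_eq_mul, Real.sin_zero, mul_zero, zero_add] at h
  rw [div_mul_cancel₀ _ ht0.ne', div_mul_eq_mul_div, div_le_iff₀ ht0] at h
  linarith

lemma mul_sin_two_mul_le {s t : ℝ} (hs : 0 < s) (hs2 : s ≤ Real.pi / 2) (hst : s ≤ t)
    (ht : t ≤ Real.pi) : s * Real.sin (2 * t) ≤ t * Real.sin (2 * s) := by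
  rcases le_total t (Real.pi / 2) with h | h
  · have := mul_sin_le_mul_sin (s := 2 * s) (t := 2 * t) (by linarith) (by linarith) (by linarith)
    linarith
  · have h1 : Real.sin (2 * t) ≤ 0 := by
      rw [← Real.sin_sub_two_pi]
      exact Real.sin_nonpos_of_nonpos_of_neg_pi_le (by linarith) (by linarith)
    have h2 : 0 ≤ Real.sin (2 * s) :=
      Real.sin_nonneg_of_nonneg_of_le_pi (by linarith) (by linarith)
    nlinarith [mul_nonneg hs.le (neg_nonneg.2 h1), mul_nonneg (hs.le.trans hst) h2]

lemma sum_pathEdges (f : ℂ × ℂ → ℝ) (v : ℕ → ℂ) (n : ℕ) :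
    ((pathEdges v n).map f).sum = ∑ i ∈ Finset.range n, f (v i, v (i + 1)) := by
  rw [pathEdges, Multiset.map_map]; rfl

/-- Among polygons inscribed in the unit circle whose sides have at least the length `2 sin α`, the
area and the perimeter are at most those of the regular polygon with sides of that length, its
number of sides being the real number `π / α`. Here the central angles are `2 a i`. -/
lemma sum_sin_le {k : ℕ} {a : ℕ → ℝ} {α : ℝ} (hα : 0 < α) (hα2 : α ≤ Real.pi / 2)
    (ha : ∀ i < k, α ≤ a i ∧ a i ≤ Real.pi) (hsum : ∑ i ∈ Finset.range k, a i = Real.pi) :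
    α * ∑ i ∈ Finset.range k, Real.sin (2 * a i) ≤ Real.pi * Real.sin (2 * α) ∧
      α * ∑ i ∈ Finset.range k, Real.sin (a i) ≤ Real.pi * Real.sin α := by
  rw [← hsum, Finset.mul_sum, Finset.mul_sum, Finset.sum_mul, Finset.sum_mul]
  constructor <;> refine Finset.sum_le_sum fun i hi => ?_
  · obtain ⟨h1, h2⟩ := ha i (Finset.mem_range.1 hi)
    exact mul_sin_two_mul_le hα hα2 h1 h2
  · obtain ⟨h1, h2⟩ := ha i (Finset.mem_range.1 hi)
    exact mul_sin_le_mul_sin hα h1 h2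

/-- Groemer's inequality for the convex hull of `V`, when all extreme points lie on the circle and
are the points `circlePoint (θ i)`. -/
lemma IsSeparatedInDisk.card_le_of_angles {q : ℝ} (hq : 0 < q) {V : Finset ℂ}
    (h : IsSeparatedInDisk q V) (hV : ExtremePointsOnCircle V) {θ : ℕ → ℝ} {n : ℕ}
    (hn : (V.filter fun x => ‖x‖ = 1).card = n + 2)
    (hper : θ (n + 2) = θ 0 + 2 * Real.pi) (hmono : ∀ i j, i < j → j ≤ n + 2 → θ i < θ j)
    (hmem : ∀ i < n + 2, circlePoint (θ i) ∈ V.filter fun x => ‖x‖ = 1)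
    (hcirc : ∀ x ∈ V.filter fun x => ‖x‖ = 1, ∃ i < n + 2, x = circlePoint (θ i))
    (hsep : ∀ i < n + 2, q ≤ ‖circlePoint (θ i) - circlePoint (θ (i + 1))‖) :
    √3 * q ^ 2 * (2 * V.card - 2)
      ≤ 2 * ∑ i ∈ Finset.range (n + 2), Real.sin (θ (i + 1) - θ i)
        + √3 * q * ∑ i ∈ Finset.range (n + 2), ‖circlePoint (θ i) - circlePoint (θ (i + 1))‖ := by
  set C := V.filter fun x => ‖x‖ = 1 with hC
  set I := V.filter fun x => ¬‖x‖ = 1 with hI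
  set v : ℕ → ℂ := fun i => circlePoint (θ i) with hv
  have hclosed : v (n + 2) = v 0 := by simp only [hv, hper, circlePoint_add_two_pi]
  have hfan : IsMesh C (fan v n) (pathEdges v (n + 2)) := by
    refine isMesh_fan hmem hclosed (fun i hi e => ?_) fun i hi => ?_
    · have := hsep i hi
      rw [show circlePoint (θ i) = circlePoint (θ (i + 1)) from e, sub_self, norm_zero] at this
      linarith
    · refine cross_circlePoint_pos (hmono _ _ (by omega) (by omega))
        (hmono _ _ (by omega) (by omega)) ?_
      rw [← hper]
      exact hmono _ _ (by omega) le_rfl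
  have hleft : ∀ x ∈ I, ∀ i < n + 2, 0 < cross (v i) (v (i + 1)) x := by
    intro x hx i hi
    rw [hI, Finset.mem_filter] at hx
    exact cross_pos_of_norm_ne_one hV (by omega) hper hmono
      (fun y hy hy1 => hcirc y (Finset.mem_filter.2 ⟨hy, hy1⟩)) hi hx.1 hx.2
  have hdisj : Disjoint C I := Finset.disjoint_filter_filter_not _ _ _
  obtain ⟨𝒯, hT, hcard⟩ := hfan.exists_insert_finset I hdisj
    (fun x hx e he => by
      obtain ⟨i, hi, rfl⟩ := Multiset.mem_map.1 he
      exact hleft x hx i (Multiset.mem_range.1 hi))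
    (fun x hx => covers_fan hclosed (hleft x hx))
  have hunion : C ∪ I = V := Finset.filter_union_filter_not_eq _ _
  have hVcard : V.card = n + 2 + I.card := by
    rw [← hn, ← Finset.card_union_of_disjoint hdisj, hunion]
  rw [hunion] at hT
  have key := hT.card_add_card_le hq h.sep
  rw [hT.sum_cross_eq, sum_pathEdges, sum_pathEdges, hcard] at key
  have hF : Multiset.card (fan v n) = n := by simp [fan]
  have hB : Multiset.card (pathEdges v (n + 2)) = n + 2 := by simp [pathEdges]
  rw [hF, hB] at key
  have hshoe : ∀ i, (v i).re * (v (i + 1)).im - (v i).im * (v (i + 1)).re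
      = Real.sin (θ (i + 1) - θ i) := by
    intro i; simp only [hv, circlePoint, Real.sin_sub]; ring
  simp only [hshoe] at key
  rw [hVcard]
  push_cast at key ⊢
  refine le_trans (le_of_eq ?_) key
  ring

lemma sqrt_twelve : √12 = 2 * √3 := by
  rw [show (12 : ℝ) = 2 ^ 2 * 3 by norm_num, Real.sqrt_mul (by norm_num), Real.sqrt_sq two_pos.le]

/-- Points of the unit disk at mutual distance at least `q` satisfy the packing inequality. The
half central angles of the sides of their convex hull, once its vertices are moved to the circle,
are called `a i`. -/
theorem IsSeparatedInDisk.card_sub_one_le {q : ℝ} (hq : 0 < q) {V : Finset ℂ}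
    (hV : IsSeparatedInDisk q V) (hcard : 2 ≤ V.card) :
    √12 * ((V.card : ℝ) - 1)
      ≤ Real.pi / Real.arcsin (q / 2) * ((q * √3 + √(4 - q ^ 2)) / q) := by
  obtain ⟨W, hW, hWc, hext⟩ := hV.exists_extremePointsOnCircle hq
  rw [← hWc] at hcard ⊢
  have hk2 := two_le_card_circle hW.norm_le hext hcard
  obtain ⟨n, hn⟩ : ∃ n, (W.filter fun x => ‖x‖ = 1).card = n + 2 :=
    ⟨_, (Nat.sub_add_cancel hk2).symm⟩
  obtain ⟨θ, hper, hmono, hmem, hcirc⟩ := exists_angles (C := W.filter fun x => ‖x‖ = 1)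
    (fun x hx => (Finset.mem_filter.1 hx).2) (Finset.card_pos.1 (by omega))
  rw [hn] at hper hmono hmem hcirc
  have hstep : ∀ i < n + 2, θ i < θ (i + 1) := fun i hi => hmono _ _ (Nat.lt_succ_self i) hi
  have hlt : ∀ i < n + 2, θ (i + 1) < θ i + 2 * Real.pi := by
    intro i hi
    rcases Nat.eq_zero_or_pos i with rfl | hi0
    · rw [← hper]; exact hmono _ _ (by omega) le_rfl
    · have h1 := hmono 0 i hi0 hi.le
      rcases (Nat.succ_le_of_lt hi).eq_or_lt with h | h
      · have : i + 1 = n + 2 := h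
        rw [this]; linarith
      · have := hmono (i + 1) (n + 2) h le_rfl
        linarith
  set a : ℕ → ℝ := fun i => (θ (i + 1) - θ i) / 2 with ha
  have hnorm : ∀ i < n + 2, ‖circlePoint (θ i) - circlePoint (θ (i + 1))‖ = 2 * Real.sin (a i) :=
    fun i hi => norm_circlePoint_sub (hstep i hi).le (hlt i hi).le
  have ha0 : ∀ i < n + 2, 0 < a i ∧ a i < Real.pi := fun i hi => by
    have h1 := hstep i hi
    have h2 := hlt i hi
    simp only [ha]
    constructor <;> linarith
  have hsep : ∀ i < n + 2, q ≤ ‖circlePoint (θ i) - circlePoint (θ (i + 1))‖ := by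
    intro i hi
    have h1 := hmem i hi
    have h2 : circlePoint (θ (i + 1)) ∈ W.filter fun x => ‖x‖ = 1 := by
      rcases (Nat.succ_le_of_lt hi).eq_or_lt with h | h
      · have : i + 1 = n + 2 := h
        rw [this, hper, circlePoint_add_two_pi]; exact hmem 0 (by omega)
      · exact hmem _ h
    refine hW.sep _ (Finset.mem_filter.1 h1).1 _ (Finset.mem_filter.1 h2).1 fun e => ?_
    have h3 := hnorm i hi
    rw [e, sub_self, norm_zero] at h3
    linarith [Real.sin_pos_of_pos_of_lt_pi (ha0 i hi).1 (ha0 i hi).2]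
  have hgroemer := hW.card_le_of_angles hq hext hn hper hmono hmem hcirc hsep
  set α := Real.arcsin (q / 2) with hα
  have hq2 : q ≤ 2 := by
    have h1 := hsep 0 (by omega)
    rw [hnorm 0 (by omega)] at h1
    linarith [Real.sin_le_one (a 0)]
  have hsα : Real.sin α = q / 2 := Real.sin_arcsin (by linarith) (by linarith)
  have hα0 : 0 < α := Real.arcsin_pos.2 (by linarith)
  have hα2 : α ≤ Real.pi / 2 := Real.arcsin_le_pi_div_two _
  have haα : ∀ i < n + 2, α ≤ a i ∧ a i ≤ Real.pi := by
    intro i hi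
    refine ⟨?_, (ha0 i hi).2.le⟩
    by_contra hlt'
    push Not at hlt'
    have h1 := hsep i hi
    rw [hnorm i hi] at h1
    have h2 := Real.sin_lt_sin_of_lt_of_le_pi_div_two (by linarith [ha0 i hi, Real.pi_pos])
      hα2 hlt'
    linarith
  have hsum : ∑ i ∈ Finset.range (n + 2), a i = Real.pi := by
    simp only [ha]
    rw [← Finset.sum_div, Finset.sum_range_sub, hper]
    ring
  obtain ⟨harea, hperim⟩ := sum_sin_le hα0 hα2 haα hsum
  have e1 : ∑ i ∈ Finset.range (n + 2), Real.sin (θ (i + 1) - θ i)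
      = ∑ i ∈ Finset.range (n + 2), Real.sin (2 * a i) :=
    Finset.sum_congr rfl fun i _ => by simp only [ha]; congr 1; ring
  have e2 : ∑ i ∈ Finset.range (n + 2), ‖circlePoint (θ i) - circlePoint (θ (i + 1))‖
      = 2 * ∑ i ∈ Finset.range (n + 2), Real.sin (a i) := by
    rw [Finset.mul_sum]
    exact Finset.sum_congr rfl fun i hi => hnorm i (Finset.mem_range.1 hi)
  rw [e1, e2] at hgroemer
  have hcα : √(4 - q ^ 2) = 2 * Real.cos α := by
    have h1 : 0 ≤ Real.cos α := Real.cos_arcsin_nonneg _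
    have h2 : 4 - q ^ 2 = (2 * Real.cos α) ^ 2 := by
      rw [mul_pow, Real.cos_sq', hsα]; ring
    rw [h2, Real.sqrt_sq (by linarith)]
  rw [hcα, sqrt_twelve, div_mul_div_comm, le_div_iff₀ (mul_pos hα0 hq)]
  rw [Real.sin_two_mul, hsα] at harea
  rw [hsα] at hperim
  have h3 := mul_le_mul_of_nonneg_left hgroemer hα0.le
  have h4 := mul_le_mul_of_nonneg_left hperim (by positivity : 0 ≤ √3 * q * 2)
  refine le_of_mul_le_mul_right ?_ hq
  linarith

/-! ### The largest admissible ratio -/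

/-- The inequality defining `packingInequalitySet` holds for small positive `q`. -/
lemma exists_pos_mem_packingInequalitySet {M : ℕ} (hM : 2 ≤ M) :
    ∃ q, 0 < q ∧ q ∈ packingInequalitySet M := by
  have hM' : (2 : ℝ) ≤ M := by exact_mod_cast hM
  have hpi := Real.pi_pos
  -- With this choice `π / arcsin (q / 2) = 2 M`.
  set α := Real.pi / (2 * M) with hα
  have hα0 : 0 < α := by positivity
  have hα2 : α ≤ Real.pi / 2 := by
    rw [hα]; exact div_le_div_of_nonneg_left hpi.le two_pos (by linarith)
  have hs : 0 < Real.sin α := Real.sin_pos_of_pos_of_lt_pi hα0 (by linarith)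
  have hs1 := Real.sin_le_one α
  refine ⟨2 * Real.sin α, by linarith, ⟨by linarith, by linarith⟩, by linarith, ?_⟩
  have harc : Real.arcsin (2 * Real.sin α / 2) = α := by
    rw [mul_div_cancel_left₀ _ two_ne_zero]
    exact Real.arcsin_sin (by linarith) hα2
  have hquot : Real.pi / α = 2 * M := by rw [hα]; field_simp
  rw [harc, hquot, sqrt_twelve, add_div, mul_div_cancel_left₀ _ (by linarith : 2 * Real.sin α ≠ 0)]
  have h1 : 0 ≤ √(4 - (2 * Real.sin α) ^ 2) / (2 * Real.sin α) := by positivity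
  have h2 := Real.sqrt_nonneg 3
  nlinarith [mul_nonneg (by linarith : (0 : ℝ) ≤ M) h1]

lemma exists_isGreatest_packingInequalitySet {M : ℕ} (hM : 2 ≤ M) :
    ∃ qm, 0 < qm ∧ IsGreatest (packingInequalitySet M) qm := by
  obtain ⟨q₀, hq₀, hmem⟩ := exists_pos_mem_packingInequalitySet hM
  set F : ℝ → ℝ := fun q => Real.pi / Real.arcsin (q / 2) * ((q * √3 + √(4 - q ^ 2)) / q)
    + √12 * (1 - (M : ℝ)) with hF
  have hcont : ContinuousOn F (Set.Icc q₀ 2) := by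
    refine ContinuousOn.add (ContinuousOn.mul (ContinuousOn.div continuousOn_const ?_ ?_)
      (ContinuousOn.div ?_ continuousOn_id ?_)) continuousOn_const
    · exact (Real.continuous_arcsin.comp (continuous_id.div_const 2)).continuousOn
    · intro q hq
      exact (Real.arcsin_pos.2 (by linarith [hq.1])).ne'
    · exact Continuous.continuousOn (by fun_prop)
    · intro q hq
      exact (hq₀.trans_le hq.1).ne'
  have hcomp : IsCompact (Set.Icc q₀ 2 ∩ F ⁻¹' Set.Ici 0) :=
    isCompact_Icc.of_isClosed_subset
      (hcont.preimage_isClosed_of_isClosed isClosed_Icc isClosed_Ici) Set.inter_subset_left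
  obtain ⟨qm, hqm, hmax⟩ := hcomp.exists_isGreatest
    ⟨q₀, ⟨le_rfl, hmem.1.2⟩, hmem.2.2⟩
  have hpos : 0 < qm := hq₀.trans_le hqm.1.1
  refine ⟨qm, hpos, ⟨⟨by linarith, hqm.1.2⟩, hpos.ne', hqm.2⟩, fun q hq => ?_⟩
  rcases le_total q₀ q with h | h
  · exact hmax ⟨⟨h, hq.1.2⟩, hq.2.2⟩
  · exact h.trans hqm.1.1

/-- After scaling the disk of the possible centres, which has radius `Rc - r_u`, to the unit disk,
the centres of a deployment are points at mutual distance at least `2 r_u / (Rc - r_u)`. -/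
lemma IsNonoverlappingDeployment.ratio_mem {M : ℕ} (hM : 2 ≤ M) {Rc θ h : ℝ}
    (hu : 0 < coverageRadius h θ) {r : Fin M → EuclideanSpace ℝ (Fin 2)}
    (hr : IsNonoverlappingDeployment M Rc θ h r) :
    0 < Rc - coverageRadius h θ ∧
      2 * coverageRadius h θ / (Rc - coverageRadius h θ) ∈ packingInequalitySet M := by
  classical
  set u := coverageRadius h θ with hu'
  have hle : 2 * u ≤ 2 * (Rc - u) := by
    have h1 := hr.no_overlap ⟨0, by omega⟩ ⟨1, by omega⟩ (by simp)
    have h2 := hr.inside ⟨0, by omega⟩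
    have h3 := hr.inside ⟨1, by omega⟩
    have h4 := norm_sub_le (r ⟨0, by omega⟩) (r ⟨1, by omega⟩)
    linarith
  have hR : 0 < Rc - u := by linarith
  refine ⟨hR, ?_⟩
  set q := 2 * u / (Rc - u) with hq
  have hq0 : 0 < q := by positivity
  have hq2 : q ≤ 2 := by rw [hq, div_le_iff₀ hR]; exact hle
  set z : Fin M → ℂ := fun j => (Rc - u)⁻¹ • Complex.orthonormalBasisOneI.repr.symm (r j) with hz
  have hdist : ∀ j k, j ≠ k → q ≤ ‖z j - z k‖ := by
    intro j k hjk
    have h1 := hr.no_overlap j k hjk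
    rw [hz, ← smul_sub, ← map_sub, norm_smul, LinearIsometryEquiv.norm_map,
      Real.norm_of_nonneg (inv_nonneg.2 hR.le), hq, div_eq_inv_mul]
    exact mul_le_mul_of_nonneg_left h1 (inv_nonneg.2 hR.le)
  have hinj : Function.Injective z := by
    intro j k hjk
    by_contra hne
    have h1 := hdist j k hne
    rw [hjk, sub_self, norm_zero] at h1
    linarith
  have hV : IsSeparatedInDisk q (Finset.univ.image z) := by
    refine ⟨fun x hx => ?_, fun x hx y hy hxy => ?_⟩
    · obtain ⟨j, -, rfl⟩ := Finset.mem_image.1 hx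
      have h1 := hr.inside j
      rw [hz, norm_smul, LinearIsometryEquiv.norm_map, Real.norm_of_nonneg (inv_nonneg.2 hR.le),
        inv_mul_le_iff₀ hR]
      linarith
    · obtain ⟨j, -, rfl⟩ := Finset.mem_image.1 hx
      obtain ⟨k, -, rfl⟩ := Finset.mem_image.1 hy
      exact hdist j k fun e => hxy (e ▸ rfl)
  have hcard : (Finset.univ.image z).card = M := by
    rw [Finset.card_image_of_injective _ hinj, Finset.card_univ, Fintype.card_fin]
  have key := hV.card_sub_one_le hq0 (by rw [hcard]; exact hM)
  rw [hcard] at key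
  exact ⟨⟨by linarith, hq2⟩, hq0.ne', by linarith⟩

theorem proposition2 (M : ℕ) (hM : 2 ≤ M) :
    ∃ qm : ℝ, IsGreatest (packingInequalitySet M) qm ∧
      ∀ (Rc θ h : ℝ), 0 < Rc → 0 < θ → θ < Real.pi → 0 < h →
        (∃ r : Fin M → EuclideanSpace ℝ (Fin 2), IsNonoverlappingDeployment M Rc θ h r) →
          h ≤ qm * Rc / ((2 + qm) * Real.tan (θ / 2)) := by
  obtain ⟨qm, hpos, hqm⟩ := exists_isGreatest_packingInequalitySet hM
  refine ⟨qm, hqm, ?_⟩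
  rintro Rc θ h - hθ hθpi hh ⟨r, hr⟩
  have htan : 0 < Real.tan (θ / 2) :=
    Real.tan_pos_of_pos_of_lt_pi_div_two (by linarith) (by linarith)
  obtain ⟨hR, hmem⟩ := hr.ratio_mem hM (mul_pos hh htan)
  have hle := hqm.2 hmem
  rw [div_le_iff₀ hR, coverageRadius] at hle
  rw [le_div_iff₀ (by positivity)]
  linarith
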